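/- Let $\delta = x\,\frac{d}{dx}$. A generalized power series is a formal series $$\varphi=\sum_{k\ge 1}c_k x^{\lambda_k},\qquad c_k,\lambda_k\in\mathbb C,$$ with pairwise distinct exponents such that $0<\operatorname{Re}\lambda_1\le\operatorname{Re}\lambda_2\le\dots\to+\infty$. Put $\delta\varphi=\sum_k\lambda_kc_kx^{\lambda_k}$. For a function $G(x,y_0,\dots,y_n)$ holomorphic in a neighbourhood of $0\in\mathbb C^{n+2}$, let $G(x,\varphi,\delta\varphi,\dots,\delta^n\varphi)$ be the formal series (with complex exponents, and possibly a constant term) obtained by substituting $x,\varphi,\delta\varphi,\dots,\delta^n\varphi$ into the Taylor series of $G$ at $0$; each of its coefficients is a finite sum. Let $F(x,y_0,\dots,y_n)$ be holomorphic in a neighbourhood of $0\in\mathbb C^{n+2}$ and let the generalized power series $\varphi$ be a formal solution of $F(x,y,\delta y,\dots,\delta^ny)=0$, that is, all coefficients of the formal series $F(x,\varphi,\delta\varphi,\dots,\delta^n\varphi)$ vanish. Suppose that there are $\nu\in\mathbb C$ and $A_0,\dots,A_n\in\mathbb C$ with $A_n\ne0$ such that, for every $j=0,1,\dots,n$, $$F'_{y_j}(x,\varphi,\delta\varphi,\dots,\delta^n\varphi)=A_jx^\nu+o(x^\nu),$$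 where $o(x^\nu)$ denotes a formal series all of whose exponents have real part strictly greater than $\operatorname{Re}\nu$. Then $\varphi$ converges uniformly in every sector with vertex $0$, of opening less than $2\pi$ and of sufficiently small radius: for all real $\alpha<\beta$ with $\beta-\alpha<2\pi$ there is $r>0$ such that the partial sums $\sum_{k=1}^{N}c_kx^{\lambda_k}$ converge uniformly, as $N\to\infty$, on the sector $\{0<|x|<r,\ \alpha<\arg x<\beta\}$, where $x^{\lambda}=e^{\lambda(\ln|x|+i\arg x)}$ with this value of $\arg x$. -/

import Mathlib

open Filter Topology

noncomputable section

namespace GenSeries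

/-- Complex exponents `z`, stored as pairs `(Re z, Im z)`. The lexicographic order only serves to
make Mathlib's Hahn series available; formal series, their sums and their products do not depend
on how the exponents are ordered. -/
abbrev Expo : Type := ℝ ×ₗ ℝ

def toExpo (z : ℂ) : Expo := toLex (z.re, z.im)

/-- Real part of an exponent. -/
def Expo.re (e : Expo) : ℝ := (ofLex e).1

/-- An exponent as a complex number. -/
def Expo.toComplex (e : Expo) : ℂ := ⟨(ofLex e).1, (ofLex e).2⟩

/-- Formal sums `∑ c_e x^e` with complex exponents. -/
abbrev FSeries : Type := HahnSeries Expo ℂ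

theorem Expo.re_add (a b : Expo) : (a + b).re = a.re + b.re := rfl

theorem Expo.re_le_of_le {a b : Expo} (h : a ≤ b) : a.re ≤ b.re := by
  rcases Prod.Lex.le_iff.1 h with h | h
  · exact h.le
  · exact h.1.le

/-- A set of exponents with finitely many elements in each left half-plane is well ordered. -/
theorem isPWO_of_finite {s : Set Expo} (h : ∀ N : ℝ, {e ∈ s | e.re ≤ N}.Finite) : s.IsPWO := by
  rw [Set.isPWO_iff_isWF]
  refine Set.isWF_iff_no_descending_seq.2 fun f hf hmem => ?_
  refine Set.infinite_of_injective_forall_mem hf.injective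
    (s := {e ∈ s | e.re ≤ (f 0).re}) (fun k => ⟨hmem k, ?_⟩) (h _)
  exact Expo.re_le_of_le (hf.antitone (Nat.zero_le k))

/-- Membership in the algebra `𝒢` of generalized power series: all exponents have positive real
part, and only finitely many of them lie in each left half-plane. -/
def IsGeneralized (f : FSeries) : Prop :=
  (∀ e ∈ f.support, 0 < e.re) ∧ ∀ N : ℝ, {e ∈ f.support | e.re ≤ N}.Finite

/-- A generalized power series `∑_k c_k x^{λ_k}`: the exponents are pairwise distinct complex
numbers with `0 < Re λ_0 ≤ Re λ_1 ≤ … → +∞`; the coefficients are arbitrary. -/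
structure GenPowerSeries where
  coeff : ℕ → ℂ
  expo : ℕ → ℂ
  expo_injective : Function.Injective expo
  re_pos : 0 < (expo 0).re
  re_mono : Monotone fun k => (expo k).re
  re_tendsto : Tendsto (fun k => (expo k).re) atTop atTop

namespace GenPowerSeries

theorem finite_re_le (φ : GenPowerSeries) (N : ℝ) : {k | (φ.expo k).re ≤ N}.Finite := by
  have h := φ.re_tendsto.eventually_gt_atTop N
  rw [← Nat.cofinite_eq_atTop] at h
  simpa [Filter.eventually_cofinite, not_lt] using h

/-- The monomials `c_k x^{λ_k}` of `φ`. -/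
def terms (φ : GenPowerSeries) : HahnSeries.SummableFamily Expo ℂ ℕ where
  toFun k := HahnSeries.single (toExpo (φ.expo k)) (φ.coeff k)
  isPWO_iUnion_support' := by
    refine isPWO_of_finite fun N => ?_
    refine ((φ.finite_re_le N).image fun k => toExpo (φ.expo k)).subset ?_
    rintro e ⟨he, hN⟩
    obtain ⟨k, hk⟩ := Set.mem_iUnion.1 he
    have hk' : e = toExpo (φ.expo k) := by
      simpa using HahnSeries.support_single_subset hk
    exact ⟨k, by rw [hk'] at hN; exact hN, hk'.symm⟩
  finite_co_support' g := by
    refine (φ.finite_re_le g.re).subset fun k hk => ?_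
    have hk' : g = toExpo (φ.expo k) := by
      simpa using HahnSeries.support_single_subset (HahnSeries.mem_support _ _ |>.2 hk)
    rw [hk']
    exact le_refl (φ.expo k).re

/-- The formal series `φ = ∑_k c_k x^{λ_k}`. -/
def toFSeries (φ : GenPowerSeries) : FSeries := φ.terms.hsum

theorem isGeneralized (φ : GenPowerSeries) : IsGeneralized φ.toFSeries := by
  have key : ∀ e ∈ φ.toFSeries.support, ∃ k, toExpo (φ.expo k) = e := by
    intro e he
    obtain ⟨k, hk⟩ := Set.mem_iUnion.1 (HahnSeries.SummableFamily.support_hsum_subset he)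
    have : e = toExpo (φ.expo k) := by
      simpa using HahnSeries.support_single_subset hk
    exact ⟨k, this.symm⟩
  refine ⟨fun e he => ?_, fun N => ?_⟩
  · obtain ⟨k, rfl⟩ := key e he
    exact lt_of_lt_of_le φ.re_pos (φ.re_mono (Nat.zero_le k))
  · refine ((φ.finite_re_le N).image fun k => toExpo (φ.expo k)).subset ?_
    rintro e ⟨he, hN⟩
    obtain ⟨k, rfl⟩ := key e he
    exact ⟨k, hN, rfl⟩

end GenPowerSeries

/-- The operator `δ = x d/dx`: `∑ c_e x^e ↦ ∑ e c_e x^e`. -/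
def delta (f : FSeries) : FSeries where
  coeff e := e.toComplex * f.coeff e
  isPWO_support' := f.isPWO_support.mono fun _ he => right_ne_zero_of_mul he

theorem IsGeneralized.delta {f : FSeries} (hf : IsGeneralized f) :
    IsGeneralized (GenSeries.delta f) := by
  have hs : (GenSeries.delta f).support ⊆ f.support := fun _ he => right_ne_zero_of_mul he
  exact ⟨fun e he => hf.1 e (hs he), fun N => (hf.2 N).subset fun e he => ⟨hs he.1, he.2⟩⟩

/-- The monomial `x`. -/
def X : FSeries := HahnSeries.single (toExpo 1) 1

theorem isGeneralized_X : IsGeneralized X := by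
  have hs : X.support ⊆ {toExpo 1} := HahnSeries.support_single_subset
  refine ⟨fun e he => ?_, fun N => (Set.finite_singleton (toExpo 1)).subset fun e he => hs he.1⟩
  rw [hs he]
  exact one_pos

/-- The tuple `(x, φ, δφ, …, δⁿφ)`. -/
def jet (n : ℕ) (f : FSeries) : Fin (n + 2) → FSeries :=
  Fin.cons X fun j : Fin (n + 1) => delta^[j] f

theorem isGeneralized_jet (n : ℕ) {f : FSeries} (hf : IsGeneralized f) (i : Fin (n + 2)) :
    IsGeneralized (jet n f i) := by
  refine Fin.cases ?_ (fun j => ?_) i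
  · exact isGeneralized_X
  · change IsGeneralized (delta^[j] f)
    induction (j : ℕ) with
    | zero => exact hf
    | succ k ih => rw [Function.iterate_succ_apply']; exact ih.delta

section Substitution

variable {d : ℕ}

/-- The monomial `y₁^{m₁} ⋯ y_d^{m_d}`. -/
def mono (y : Fin d → FSeries) (m : Fin d → ℕ) : FSeries := ∏ i, y i ^ m i

theorem exists_pos_bound {f : FSeries} (hf : IsGeneralized f) :
    ∃ ε > 0, ∀ e ∈ f.support, ε ≤ e.re := by
  by_cases h : f.support.Nonempty
  · have hm := Set.IsWF.min_mem f.isWF_support h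
    exact ⟨_, hf.1 _ hm, fun e he => Expo.re_le_of_le (Set.IsWF.min_le _ _ he)⟩
  · exact ⟨1, one_pos, fun e he => (h ⟨e, he⟩).elim⟩

/-- Supports bounded on the left by `b`, with finitely many exponents in each left half-plane. -/
def Bdd (b : ℝ) (f : FSeries) : Prop :=
  (∀ e ∈ f.support, b ≤ e.re) ∧ ∀ N : ℝ, {e ∈ f.support | e.re ≤ N}.Finite

theorem Bdd.mul {a b : ℝ} {f g : FSeries} (hf : Bdd a f) (hg : Bdd b g) :
    Bdd (a + b) (f * g) := by
  have hs : ∀ e ∈ (f * g).support, ∃ u ∈ f.support, ∃ v ∈ g.support, u + v = e := by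
    intro e he
    obtain ⟨u, hu, v, hv, h⟩ := HahnSeries.support_mul_subset he
    exact ⟨u, hu, v, hv, h⟩
  refine ⟨fun e he => ?_, fun N => ?_⟩
  · obtain ⟨u, hu, v, hv, rfl⟩ := hs e he
    rw [Expo.re_add]
    exact add_le_add (hf.1 u hu) (hg.1 v hv)
  · refine (((hf.2 (N - b)).prod (hg.2 (N - a))).image fun p => p.1 + p.2).subset ?_
    rintro e ⟨he, hN⟩
    obtain ⟨u, hu, v, hv, rfl⟩ := hs e he
    rw [Expo.re_add] at hN
    have h1 := hf.1 u hu
    have h2 := hg.1 v hv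
    exact ⟨(u, v), ⟨⟨hu, by linarith⟩, ⟨hv, by linarith⟩⟩, rfl⟩

theorem bdd_one : Bdd 0 1 := by
  have hs : (1 : FSeries).support ⊆ {0} := HahnSeries.support_single_subset
  refine ⟨fun e he => ?_, fun N => (Set.finite_singleton (0 : Expo)).subset fun e he => hs he.1⟩
  rw [hs he]
  exact le_refl (0 : ℝ)

theorem Bdd.pow {a : ℝ} {f : FSeries} (hf : Bdd a f) (k : ℕ) : Bdd (k * a) (f ^ k) := by
  induction k with
  | zero => simpa using bdd_one
  | succ k ih =>
    rw [pow_succ]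
    have := ih.mul hf
    rwa [show ((k + 1 : ℕ) : ℝ) * a = k * a + a by push_cast; ring]

theorem bdd_mono {ε : ℝ} {y : Fin d → FSeries} (hy : ∀ i, Bdd ε (y i)) (m : Fin d → ℕ) :
    Bdd (((∑ i, m i : ℕ) : ℝ) * ε) (mono y m) := by
  unfold mono
  have : ∀ s : Finset (Fin d), Bdd (((∑ i ∈ s, m i : ℕ) : ℝ) * ε) (∏ i ∈ s, y i ^ m i) := by
    intro s
    induction s using Finset.induction_on with
    | empty => simpa using bdd_one
    | insert i s hi ih =>
      rw [Finset.prod_insert hi, Finset.sum_insert hi]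
      have := ((hy i).pow (m i)).mul ih
      rwa [show ((m i + ∑ i ∈ s, m i : ℕ) : ℝ) * ε
        = m i * ε + ((∑ i ∈ s, m i : ℕ) : ℝ) * ε by push_cast; ring]
  exact this Finset.univ

/-- Only finitely many monomials in generalized power series reach a given left half-plane. -/
theorem finite_mono {y : Fin d → FSeries} (hy : ∀ i, IsGeneralized (y i)) (N : ℝ) :
    {m : Fin d → ℕ | ∃ e ∈ (mono y m).support, e.re ≤ N}.Finite := by
  choose ε hε hle using fun i => exists_pos_bound (hy i)
  obtain ⟨ε₀, hε₀, hmin⟩ : ∃ ε₀ > 0, ∀ i, ε₀ ≤ ε i := by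
    rcases isEmpty_or_nonempty (Fin d) with h | h
    · exact ⟨1, one_pos, fun i => h.elim i⟩
    · obtain ⟨i, hi⟩ := Finite.exists_min ε
      exact ⟨ε i, hε i, hi⟩
  have hB : ∀ i, Bdd ε₀ (y i) := fun i =>
    ⟨fun e he => (hmin i).trans (hle i e he), (hy i).2⟩
  refine (Set.finite_Iic fun _ : Fin d => ⌈N / ε₀⌉₊).subset ?_
  rintro m ⟨e, he, hN⟩ i
  have h1 := (bdd_mono hB m).1 e he
  have h2 : ((∑ i, m i : ℕ) : ℝ) ≤ N / ε₀ := by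
    rw [le_div_iff₀ hε₀]; linarith
  have h3 : m i ≤ ∑ i, m i := Finset.single_le_sum (fun _ _ => Nat.zero_le _) (Finset.mem_univ i)
  exact h3.trans (by exact_mod_cast h2.trans (Nat.le_ceil _))

theorem finite_mono_support {y : Fin d → FSeries} (hy : ∀ i, IsGeneralized (y i))
    (m : Fin d → ℕ) (N : ℝ) : {e ∈ (mono y m).support | e.re ≤ N}.Finite := by
  refine (bdd_mono (ε := 0) (fun i => ⟨fun e he => ((hy i).1 e he).le, (hy i).2⟩) m).2 N

/-- The summable family `a_m y^m`, `m` running over the multi-indices. -/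
def substFamily (a : (Fin d → ℕ) → ℂ) (y : Fin d → FSeries) (hy : ∀ i, IsGeneralized (y i)) :
    HahnSeries.SummableFamily Expo ℂ (Fin d → ℕ) where
  toFun m := a m • mono y m
  isPWO_iUnion_support' := by
    refine isPWO_of_finite fun N => ?_
    refine ((finite_mono hy N).biUnion fun m _ => finite_mono_support hy m N).subset ?_
    rintro e ⟨he, hN⟩
    obtain ⟨m, hm⟩ := Set.mem_iUnion.1 he
    have hm' : e ∈ (mono y m).support := right_ne_zero_of_mul (a := a m) hm
    exact Set.mem_biUnion (show m ∈ {m | _} from ⟨e, hm', hN⟩) ⟨hm', hN⟩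
  finite_co_support' g :=
    (finite_mono hy g.re).subset fun m hm =>
      ⟨g, right_ne_zero_of_mul (a := a m) hm, le_refl _⟩

/-- The Taylor coefficient `(∂^m F)(0) / m!` of `F` at the origin. -/
def taylorCoeff (F : (Fin d → ℂ) → ℂ) (m : Fin d → ℕ) : ℂ :=
  (∏ i, ((m i).factorial : ℂ))⁻¹ *
    iteratedFDeriv ℂ (∑ i, m i) F 0 fun k => Pi.single (finSigmaFinEquiv.symm k).1 1

/-- The formal series `F(y₁, …, y_d) = ∑_m a_m y^m`, where `∑_m a_m z^m` is the Taylor series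
of `F` at the origin. -/
def subst (F : (Fin d → ℂ) → ℂ) (y : Fin d → FSeries) (hy : ∀ i, IsGeneralized (y i)) : FSeries :=
  (substFamily (taylorCoeff F) y hy).hsum

/-- The partial derivative of `F` with respect to the variable number `i`. -/
def partialDeriv (F : (Fin d → ℂ) → ℂ) (i : Fin d) : (Fin d → ℂ) → ℂ :=
  fun z => fderiv ℂ F z (Pi.single i 1)

end Substitution

/-- The formal series `F(x, φ, δφ, …, δⁿφ)`. -/
def evalAlong {n : ℕ} (F : (Fin (n + 2) → ℂ) → ℂ) (φ : GenPowerSeries) : FSeries :=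
  subst F (jet n φ.toFSeries) (isGeneralized_jet n φ.isGeneralized)

/-- `φ` formally satisfies `F(x, y, δy, …, δⁿy) = 0`. -/
def IsFormalSolution {n : ℕ} (F : (Fin (n + 2) → ℂ) → ℂ) (φ : GenPowerSeries) : Prop :=
  evalAlong F φ = 0

/-- `f = A x^ν + o(x^ν)`: all exponents of `f - A x^ν` have real part greater than `Re ν`. -/
def HasLeadingTerm (f : FSeries) (A ν : ℂ) : Prop :=
  ∀ e ∈ (f - HahnSeries.single (toExpo ν) A).support, ν.re < e.re

/-- The argument of `x` in `(α, α + 2π]`. -/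
def argFrom (α : ℝ) (x : ℂ) : ℝ := toIocMod Real.two_pi_pos α x.arg

/-- The open sector `0 < |x| < r`, `α < arg x < β` (used for `α < β < α + 2π`). -/
def sector (α β r : ℝ) : Set ℂ := {x | 0 < ‖x‖ ∧ ‖x‖ < r ∧ argFrom α x < β}

/-- The power `x^s = exp (s log x)` for the branch of the logarithm with `α < arg x ≤ α + 2π`. -/
def powFrom (α : ℝ) (x s : ℂ) : ℂ :=
  Complex.exp (s * (Real.log ‖x‖ + argFrom α x * Complex.I))

end GenSeries

end

namespace GenSeries

open scoped ENNReal

/-! The proof is a majorant argument in the weighted norms `∑ |c_e| r^{Re e} exp(C |Im e|)`. If `C`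
bounds the arguments in the sector, finiteness of this norm for `φ` gives uniform convergence by the
Weierstrass test. The norm is submultiplicative on series whose exponents have nonnegative real
part, so analytic substitutions are controlled by their Taylor coefficients.

Write `φ = f₀ + u`, where `f₀` is the finite part with `Re e < K` and `u` has `Re e ≥ K`. Taylor
expansion around `f₀` (`exists_subst_expansion`) turns the equation into `x^ν L(δ)u = -(P + ∑ (δ^j
u) D_j + Q)`, with `L(z) = ∑ A_j z^j`, `P` the value of `F` along `f₀`, `D_j = o(x^ν)`, and `Q` of
order at least two in `u`. Since `A_n ≠ 0`, `|L(z)| ≥ c |z|^n` for large `|z|`: there are no small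
denominators, and inverting `L(δ)` controls even the top derivative `δ^n u`
(`wnorm_delta_iterate_le_of_eq`).

No norm of `u` is known to be finite beforehand, so the estimate is made on truncations `Re e ≤ N`.
After division by `x^ν`, each `D_j` raises real parts by at least `ε`, and in `Q` each factor `u` is
accompanied by another one of order `K`. Hence the truncation of `δ^n u` at `N` is bounded through
the one at `N - ε` (`wnorm_cut_step`). For small `r` the bound `r^(K-1)` reproduces itself;
induction in steps of `ε`, then `N → ∞`, proves `exists_wnorm_lt_top`. -/

/-! ### Lower bounds for the real parts of exponents -/

/-- All exponents of `f` have real part at least `p`. -/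
def SuppGE (p : ℝ) (f : FSeries) : Prop := ∀ e ∈ f.support, p ≤ e.re

theorem SuppGE.mono {p q : ℝ} {f : FSeries} (hf : SuppGE p f) (h : q ≤ p) : SuppGE q f :=
  fun e he => h.trans (hf e he)

theorem SuppGE.mul {p q : ℝ} {f g : FSeries} (hf : SuppGE p f) (hg : SuppGE q g) :
    SuppGE (p + q) (f * g) := by
  intro e he
  obtain ⟨u, hu, v, hv, rfl⟩ := HahnSeries.support_mul_subset he
  exact add_le_add (hf u hu) (hg v hv)

theorem SuppGE.add {p : ℝ} {f g : FSeries} (hf : SuppGE p f) (hg : SuppGE p g) :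
    SuppGE p (f + g) := by
  intro e he
  rcases HahnSeries.support_add_subset _ _ he with h | h
  · exact hf e h
  · exact hg e h

theorem suppGE_zero (p : ℝ) : SuppGE p 0 := fun e he => by simp at he

theorem suppGE_one : SuppGE 0 1 := bdd_one.1

theorem SuppGE.smul {p : ℝ} {f : FSeries} (hf : SuppGE p f) (c : ℂ) : SuppGE p (c • f) :=
  fun e he => hf e (right_ne_zero_of_mul (a := c) he)

theorem SuppGE.sum {ι : Type*} {p : ℝ} {s : Finset ι} {f : ι → FSeries}
    (hf : ∀ i ∈ s, SuppGE p (f i)) : SuppGE p (∑ i ∈ s, f i) := by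
  classical
  induction s using Finset.induction_on with
  | empty => simpa using suppGE_zero p
  | insert i s hi ih =>
    rw [Finset.sum_insert hi]
    exact (hf i (by simp)).add (ih fun j hj => hf j (by simp [hj]))

theorem SuppGE.hsum {ι : Type*} {p : ℝ} {s : HahnSeries.SummableFamily Expo ℂ ι}
    (hs : ∀ i, SuppGE p (s i)) : SuppGE p s.hsum := by
  intro e he
  obtain ⟨i, hi⟩ := Set.mem_iUnion.1 (HahnSeries.SummableFamily.support_hsum_subset he)
  exact hs i e hi

theorem suppGE_mono {d : ℕ} {y : Fin d → FSeries} (hy : ∀ i, SuppGE 0 (y i)) (m : Fin d → ℕ) :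
    SuppGE 0 (mono y m) := by
  unfold mono
  refine Finset.prod_induction _ (SuppGE 0) (fun a b ha hb => by simpa using ha.mul hb)
    suppGE_one fun i _ => ?_
  induction m i with
  | zero => simpa using suppGE_one
  | succ k ih => rw [pow_succ]; simpa using ih.mul (hy i)

theorem IsGeneralized.suppGE {f : FSeries} (hf : IsGeneralized f) : SuppGE 0 f :=
  fun e he => (hf.1 e he).le

/-! ### Weighted `ℓ¹` norms -/

/-- The weighted `ℓ¹` norm `∑_e |f_e| W(e)`. -/
noncomputable def wnorm (W : Expo → ℝ≥0∞) (f : FSeries) : ℝ≥0∞ := ∑' e, ‖f.coeff e‖ₑ * W e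

theorem wnorm_zero (W : Expo → ℝ≥0∞) : wnorm W 0 = 0 := by simp [wnorm]

theorem wnorm_le_mul {W W' : Expo → ℝ≥0∞} {f : FSeries} (c : ℝ≥0∞)
    (h : ∀ e ∈ f.support, W e ≤ c * W' e) : wnorm W f ≤ c * wnorm W' f := by
  unfold wnorm
  rw [← ENNReal.tsum_mul_left]
  refine ENNReal.tsum_le_tsum fun e => ?_
  by_cases he : f.coeff e = 0
  · simp [he]
  · calc ‖f.coeff e‖ₑ * W e ≤ ‖f.coeff e‖ₑ * (c * W' e) := by gcongr; exact h e he
      _ = _ := by ring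

theorem wnorm_mono {W W' : Expo → ℝ≥0∞} {f : FSeries}
    (h : ∀ e ∈ f.support, W e ≤ W' e) : wnorm W f ≤ wnorm W' f := by
  simpa using wnorm_le_mul (f := f) 1 (by simpa using h)

theorem wnorm_add_le (W : Expo → ℝ≥0∞) (f g : FSeries) :
    wnorm W (f + g) ≤ wnorm W f + wnorm W g := by
  unfold wnorm
  rw [← ENNReal.tsum_add]
  refine ENNReal.tsum_le_tsum fun e => ?_
  rw [← add_mul, HahnSeries.coeff_add]
  gcongr
  exact enorm_add_le _ _

theorem wnorm_sum_le {ι : Type*} (W : Expo → ℝ≥0∞) (s : Finset ι) (f : ι → FSeries) :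
    wnorm W (∑ i ∈ s, f i) ≤ ∑ i ∈ s, wnorm W (f i) := by
  classical
  induction s using Finset.induction_on with
  | empty => simp [wnorm_zero]
  | insert i s hi ih =>
    rw [Finset.sum_insert hi, Finset.sum_insert hi]
    exact (wnorm_add_le _ _ _).trans (by gcongr)

theorem wnorm_neg (W : Expo → ℝ≥0∞) (f : FSeries) : wnorm W (-f) = wnorm W f := by
  simp [wnorm]

theorem wnorm_smul (W : Expo → ℝ≥0∞) (c : ℂ) (f : FSeries) :
    wnorm W (c • f) = ‖c‖ₑ * wnorm W f := by
  simp [wnorm, ← ENNReal.tsum_mul_left, mul_assoc]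

theorem wnorm_single (W : Expo → ℝ≥0∞) (e : Expo) (c : ℂ) :
    wnorm W (HahnSeries.single e c) = ‖c‖ₑ * W e := by
  unfold wnorm
  rw [tsum_eq_single e]
  · simp
  · intro b hb
    simp [HahnSeries.coeff_single_of_ne hb]

theorem wnorm_lt_top {W : Expo → ℝ≥0∞} {f : FSeries} (hf : f.support.Finite)
    (hW : ∀ e, W e ≠ ∞) : wnorm W f < ∞ := by
  unfold wnorm
  rw [tsum_eq_sum (s := hf.toFinset) (by
    intro e he
    simp only [Set.Finite.mem_toFinset, HahnSeries.mem_support, not_not] at he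
    simp [he])]
  exact ENNReal.sum_lt_top.2 fun e _ => ENNReal.mul_lt_top (by simp) (hW e).lt_top

/-- Triangle inequality in the convolution, then Tonelli. Three separate weights are allowed so that
the two factors may be truncated at different levels. -/
theorem wnorm_mul_le {W W₁ W₂ : Expo → ℝ≥0∞} {f g : FSeries}
    (h : ∀ a ∈ f.support, ∀ b ∈ g.support, W (a + b) ≤ W₁ a * W₂ b) :
    wnorm W (f * g) ≤ wnorm W₁ f * wnorm W₂ g := by
  classical
  let T : Expo × Expo → ℝ≥0∞ := fun p => (‖f.coeff p.1‖ₑ * W₁ p.1) * (‖g.coeff p.2‖ₑ * W₂ p.2)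
  have h1 : ∀ e, ‖(f * g).coeff e‖ₑ * W e ≤ ∑' p : Expo × Expo, if p.1 + p.2 = e then T p else 0 := by
    intro e
    rw [HahnSeries.coeff_mul]
    set S := Finset.antidiagonal f.isPWO_support g.isPWO_support e with hS
    calc _ ≤ (∑ p ∈ S, ‖f.coeff p.1 * g.coeff p.2‖ₑ) * W e := by
          gcongr; exact enorm_sum_le _ _
      _ ≤ ∑ p ∈ S, if p.1 + p.2 = e then T p else 0 := by
          rw [Finset.sum_mul]
          refine Finset.sum_le_sum fun p hp => ?_
          rw [Finset.mem_antidiagonal] at hp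
          rw [if_pos hp.2.2, enorm_mul, ← hp.2.2]
          calc _ ≤ ‖f.coeff p.1‖ₑ * ‖g.coeff p.2‖ₑ * (W₁ p.1 * W₂ p.2) := by
                gcongr; exact h _ hp.1 _ hp.2.1
            _ = T p := by simp only [T]; ring
      _ ≤ _ := ENNReal.sum_le_tsum _
  calc wnorm W (f * g) ≤ ∑' e, ∑' p : Expo × Expo, if p.1 + p.2 = e then T p else 0 :=
        ENNReal.tsum_le_tsum h1
    _ = ∑' p : Expo × Expo, ∑' e, if p.1 + p.2 = e then T p else 0 := ENNReal.tsum_comm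
    _ = ∑' p : Expo × Expo, T p := by simp
    _ = wnorm W₁ f * wnorm W₂ g := by
        rw [ENNReal.tsum_prod (f := fun a b => T (a, b))]
        simp only [T, wnorm, ENNReal.tsum_mul_left, ENNReal.tsum_mul_right]

theorem wnorm_hsum_le {ι : Type*} (W : Expo → ℝ≥0∞) (s : HahnSeries.SummableFamily Expo ℂ ι) :
    wnorm W s.hsum ≤ ∑' i, wnorm W (s i) := by
  unfold wnorm
  rw [ENNReal.tsum_comm]
  refine ENNReal.tsum_le_tsum fun e => ?_
  rw [ENNReal.tsum_mul_right, HahnSeries.SummableFamily.coeff_hsum_eq_sum]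
  gcongr
  exact (enorm_sum_le _ _).trans (ENNReal.sum_le_tsum _)

/-- Submultiplicativity of a weight on the exponents with nonnegative real part. -/
structure IsWeight (W : Expo → ℝ≥0∞) : Prop where
  zero_le_one : W 0 ≤ 1
  add_le : ∀ a b : Expo, 0 ≤ a.re → 0 ≤ b.re → W (a + b) ≤ W a * W b

theorem IsWeight.wnorm_mono_le {W : Expo → ℝ≥0∞} (hW : IsWeight W) {d : ℕ}
    {y : Fin d → FSeries} (hy : ∀ i, SuppGE 0 (y i)) {s : ℝ≥0∞} (hs : ∀ i, wnorm W (y i) ≤ s)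
    (m : Fin d → ℕ) : wnorm W (mono y m) ≤ s ^ ∑ i, m i := by
  have hone : wnorm W 1 ≤ 1 := by
    change wnorm W (HahnSeries.single 0 1) ≤ 1
    rw [wnorm_single]; simpa using hW.zero_le_one
  have hmul : ∀ f g : FSeries, SuppGE 0 f → SuppGE 0 g →
      wnorm W (f * g) ≤ wnorm W f * wnorm W g := fun f g hf hg =>
    wnorm_mul_le fun a ha b hb => hW.add_le a b (hf a ha) (hg b hb)
  have hpow : ∀ i k, SuppGE 0 (y i ^ k) ∧ wnorm W (y i ^ k) ≤ s ^ k := by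
    intro i k
    induction k with
    | zero => simpa using ⟨suppGE_one, hone⟩
    | succ k ih =>
      rw [pow_succ, pow_succ]
      exact ⟨by simpa using ih.1.mul (hy i),
        (hmul _ _ ih.1 (hy i)).trans (mul_le_mul' ih.2 (hs i))⟩
  have key : ∀ t : Finset (Fin d), SuppGE 0 (∏ i ∈ t, y i ^ m i) ∧
      wnorm W (∏ i ∈ t, y i ^ m i) ≤ s ^ ∑ i ∈ t, m i := by
    intro t
    induction t using Finset.induction_on with
    | empty => simpa using ⟨suppGE_one, hone⟩
    | insert i t hi ih =>
      rw [Finset.prod_insert hi, Finset.sum_insert hi, pow_add]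
      exact ⟨by simpa using (hpow i (m i)).1.mul ih.1,
        (hmul _ _ (hpow i _).1 ih.1).trans (mul_le_mul' (hpow i _).2 ih.2)⟩
  exact (key Finset.univ).2

/-! ### Exponential weights and their truncations -/

/-- The weight `r^{Re e} exp(C |Im e|)`. -/
noncomputable def weight (C r : ℝ) (e : Expo) : ℝ≥0∞ :=
  ENNReal.ofReal (r ^ e.re * Real.exp (C * |(ofLex e).2|))

/-- The weight `W` restricted to the exponents with real part at most `N`. -/
noncomputable def cut (N : ℝ) (W : Expo → ℝ≥0∞) (e : Expo) : ℝ≥0∞ := if e.re ≤ N then W e else 0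

theorem weight_ne_top (C r : ℝ) (e : Expo) : weight C r e ≠ ∞ := ENNReal.ofReal_ne_top

theorem weight_add_le {C r : ℝ} (hC : 0 ≤ C) (hr : 0 < r) (a b : Expo) :
    weight C r (a + b) ≤ weight C r a * weight C r b := by
  unfold weight
  rw [← ENNReal.ofReal_mul (by positivity)]
  refine ENNReal.ofReal_le_ofReal ?_
  rw [Expo.re_add, Real.rpow_add hr, mul_mul_mul_comm, ← Real.exp_add, ← mul_add]
  have : |(ofLex (a + b)).2| ≤ |(ofLex a).2| + |(ofLex b).2| := abs_add_le _ _
  gcongr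

theorem weight_zero (C r : ℝ) : weight C r 0 = 1 := by
  have h1 : (0 : Expo).re = 0 := rfl
  simp [weight, h1]

theorem isWeight_weight {C r : ℝ} (hC : 0 ≤ C) (hr : 0 < r) : IsWeight (weight C r) :=
  ⟨(weight_zero C r).le, fun a b _ _ => weight_add_le hC hr a b⟩

/-- Shrinking the radius gains a power of `r / r₀` determined by the lowest exponent, since the
factor in `Im e` does not depend on the radius. All smallness in the proof comes from this gain. -/
theorem weight_le_mul {C r r₀ p : ℝ} (hr : 0 < r) (hr₀ : r ≤ r₀) {e : Expo} (he : p ≤ e.re) :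
    weight C r e ≤ ENNReal.ofReal ((r / r₀) ^ p) * weight C r₀ e := by
  have h0 : 0 < r₀ := hr.trans_le hr₀
  unfold weight
  rw [← ENNReal.ofReal_mul (by positivity)]
  refine ENNReal.ofReal_le_ofReal ?_
  have h1 : r ^ e.re = (r / r₀) ^ e.re * r₀ ^ e.re := by
    rw [Real.div_rpow hr.le h0.le, div_mul_cancel₀]; positivity
  rw [h1, ← mul_assoc]
  gcongr ?_ * _ * _
  exact Real.rpow_le_rpow_of_exponent_ge (by positivity) (div_le_one_of_le₀ hr₀ h0.le) he

theorem cut_le (N : ℝ) (W : Expo → ℝ≥0∞) (e : Expo) : cut N W e ≤ W e := by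
  unfold cut; split_ifs <;> simp

theorem cut_mono {M N : ℝ} (h : M ≤ N) (W : Expo → ℝ≥0∞) (e : Expo) : cut M W e ≤ cut N W e := by
  unfold cut
  split_ifs with h1 h2
  · exact le_rfl
  · exact absurd (h1.trans h) h2
  · simp
  · simp

/-- If `a + b` stays below `N` and `b` is at least `q`, then `a` is below `N - q`, and
symmetrically. This lowering of the truncation level drives the final induction. -/
theorem cut_add_le {C r : ℝ} (hC : 0 ≤ C) (hr : 0 < r) {N p q : ℝ} {a b : Expo}
    (ha : p ≤ a.re) (hb : q ≤ b.re) :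
    cut N (weight C r) (a + b) ≤ cut (N - q) (weight C r) a * cut (N - p) (weight C r) b := by
  unfold cut
  by_cases h : (a + b).re ≤ N
  · have h' := h
    rw [Expo.re_add] at h'
    rw [if_pos h, if_pos (by linarith), if_pos (by linarith)]
    exact weight_add_le hC hr a b
  · simp [h]

theorem isWeight_cut {C r : ℝ} (hC : 0 ≤ C) (hr : 0 < r) (N : ℝ) :
    IsWeight (cut N (weight C r)) :=
  ⟨(cut_le _ _ _).trans (weight_zero C r).le, fun a b ha hb => by
    simpa using cut_add_le (N := N) hC hr ha hb⟩

theorem wnorm_cut_mul_le {C r : ℝ} (hC : 0 ≤ C) (hr : 0 < r) {N p q : ℝ} {f g : FSeries}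
    (hf : SuppGE p f) (hg : SuppGE q g) :
    wnorm (cut N (weight C r)) (f * g) ≤
      wnorm (cut (N - q) (weight C r)) f * wnorm (cut (N - p) (weight C r)) g :=
  wnorm_mul_le fun a ha b hb => cut_add_le hC hr (hf a ha) (hg b hb)

/-! ### Taylor coefficients: derivatives and growth -/

section Taylor

variable {d : ℕ}

theorem card_fiber_finSigmaFinEquiv (m : Fin d → ℕ) (i : Fin d) :
    Fintype.card {j : Fin (∑ i, m i) // (finSigmaFinEquiv.symm j).1 = i} = m i := by
  have e : {j : Fin (∑ i, m i) // (finSigmaFinEquiv.symm j).1 = i} ≃ Fin (m i) :=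
    (finSigmaFinEquiv.symm.subtypeEquiv (q := fun p => p.1 = i) fun _ => Iff.rfl).trans
      (Equiv.sigmaSubtype i)
  rw [Fintype.card_congr e, Fintype.card_fin]

/-- Taylor coefficients can be computed with the directions in any order. -/
theorem taylorCoeff_eq {F : (Fin d → ℂ) → ℂ} (hF : AnalyticAt ℂ F 0) (m : Fin d → ℕ) {k : ℕ}
    (idx : Fin k → Fin d) (h : ∀ i, Fintype.card {j // idx j = i} = m i) :
    taylorCoeff F m = (∏ i, ((m i).factorial : ℂ))⁻¹ *
      iteratedFDeriv ℂ k F 0 fun j => Pi.single (idx j) 1 := by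
  obtain rfl : k = ∑ i, m i := by
    simp_rw [← h]
    rw [← Fintype.card_sigma, Fintype.card_congr (Equiv.sigmaFiberEquiv idx), Fintype.card_fin]
  have e : ∀ i, Nonempty ({j // idx j = i} ≃
      {j : Fin (∑ i, m i) // (finSigmaFinEquiv.symm j).1 = i}) := fun i =>
    Fintype.card_eq.1 ((h i).trans (card_fiber_finSigmaFinEquiv m i).symm)
  let σ : Equiv.Perm (Fin (∑ i, m i)) := Equiv.ofFiberEquiv fun i => (e i).some
  have hσ : ∀ j, (finSigmaFinEquiv.symm (σ j)).1 = idx j := fun j =>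
    Equiv.ofFiberEquiv_map (g := fun j => (finSigmaFinEquiv.symm j).1) (fun i => (e i).some) j
  unfold taylorCoeff
  rw [← hF.contDiffAt.iteratedFDeriv_comp_perm _ σ]
  simp only [Function.comp_def, hσ]

/-- The order of differentiation is irrelevant, so direction `i` may be taken last; the factor is
the quotient of `(m i + 1)!` by `(m i)!`. -/
theorem taylorCoeff_partialDeriv {F : (Fin d → ℂ) → ℂ} (hF : AnalyticAt ℂ F 0) (i : Fin d)
    (m : Fin d → ℕ) :
    taylorCoeff (partialDeriv F i) m = (m i + 1 : ℂ) * taylorCoeff F (m + Pi.single i 1) := by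
  set idx : Fin (∑ i, m i) → Fin d := fun j => (finSigmaFinEquiv.symm j).1 with hidx
  have hcard : ∀ l, Fintype.card {j // (Fin.snoc idx i : Fin (∑ i, m i + 1) → Fin d) j = l} =
      (m + Pi.single i 1 : Fin d → ℕ) l := by
    intro l
    rw [Fintype.card_subtype, Finset.card_filter, Fin.sum_univ_castSucc, Pi.add_apply]
    simp only [Fin.snoc_castSucc, Fin.snoc_last]
    rw [← Finset.card_filter, ← Fintype.card_subtype, card_fiber_finSigmaFinEquiv]
    simp [Pi.single_apply, eq_comm]
  rw [taylorCoeff_eq hF _ _ hcard, iteratedFDeriv_succ_apply_right]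
  have h1 : (Fin.init fun j => (Pi.single ((Fin.snoc idx i : Fin (∑ i, m i + 1) → Fin d) j) 1 :
      Fin d → ℂ)) = fun j => Pi.single (idx j) 1 := by
    funext j
    simp [Fin.init]
  rw [h1, Fin.snoc_last]
  have h2 : partialDeriv F i = (ContinuousLinearMap.apply ℂ ℂ (Pi.single i 1 : Fin d → ℂ)) ∘
      fun z => fderiv ℂ F z := rfl
  have h3 : (∏ l, (((m + Pi.single i 1 : Fin d → ℕ) l).factorial : ℂ)) =
      (m i + 1) * ∏ l, ((m l).factorial : ℂ) := by
    rw [← Finset.mul_prod_erase _ _ (Finset.mem_univ i),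
      ← Finset.mul_prod_erase Finset.univ (fun l => ((m l).factorial : ℂ)) (Finset.mem_univ i),
      ← mul_assoc]
    congr 1
    · simp [Nat.factorial_succ]
    · refine Finset.prod_congr rfl fun l hl => ?_
      simp [Finset.ne_of_mem_erase hl]
  have h4 : (m i + 1 : ℂ) ≠ 0 := by exact_mod_cast Nat.succ_ne_zero (m i)
  rw [h3, mul_inv, ← mul_assoc, mul_inv_cancel_left₀ h4, h2]
  unfold taylorCoeff
  rw [ContinuousLinearMap.iteratedFDeriv_comp_left _
    (hF.fderiv.contDiffAt (n := ⊤)) (by exact le_top)]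
  rfl

/-- The `k`-th derivative is a sum over permutations of values of the degree `k` term of the power
series, hence at most `k! C / ρ^k` on unit vectors. The remaining quotient of factorials is a
multinomial coefficient, at most `d^k`. -/
theorem norm_taylorCoeff_le {F : (Fin d → ℂ) → ℂ} (hF : AnalyticAt ℂ F 0) :
    ∃ C B : ℝ, 0 < C ∧ 0 < B ∧ ∀ m, ‖taylorCoeff F m‖ ≤ C * B ^ ∑ i, m i := by
  obtain ⟨p, R, hp⟩ := hF
  obtain ⟨ρ, hρ, hρR⟩ := ENNReal.lt_iff_exists_nnreal_btwn.1 (hp.r_pos.trans_le hp.r_le)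
  have hρ0 : 0 < ρ := by exact_mod_cast hρ
  obtain ⟨C, hC, hle⟩ := p.norm_le_div_pow_of_pos_of_lt_radius hρ0 hρR
  -- `d + 1` instead of `d` keeps the base positive when `d = 0`.
  refine ⟨C, (d + 1) / ρ, hC, by positivity, fun m => ?_⟩
  set k := ∑ i, m i with hk
  have h1 : ∀ v : Fin k → Fin d → ℂ, (∀ j, ‖v j‖ ≤ 1) →
      ‖iteratedFDeriv ℂ k F 0 v‖ ≤ k.factorial * (C / ρ ^ k) := by
    intro v hv
    rw [hp.iteratedFDeriv_eq_sum_of_completeSpace]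
    refine (norm_sum_le_of_le (f := fun σ : Equiv.Perm (Fin k) => p k fun i => v (σ i))
      (n := fun _ => C / ρ ^ k) _ fun σ _ => ?_).trans ?_
    · refine ((p k).le_opNorm _).trans ?_
      have : ∏ i, ‖v (σ i)‖ ≤ 1 := Finset.prod_le_one (fun _ _ => norm_nonneg _) fun i _ => hv _
      calc _ ≤ ‖p k‖ * 1 := by gcongr
        _ ≤ _ := by simpa using hle k
    · simp [Fintype.card_perm]
  have h2 : (k.factorial : ℝ) = (∏ i, ((m i).factorial : ℝ)) * Nat.multinomial Finset.univ m := by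
    exact_mod_cast (Nat.multinomial_spec Finset.univ m).symm
  have h3 : (Nat.multinomial Finset.univ m : ℝ) ≤ (d + 1) ^ k := by
    have : Nat.multinomial Finset.univ m ≤ d ^ k := by
      have h := Finset.sum_pow_eq_sum_piAntidiag (Finset.univ : Finset (Fin d)) (fun _ => 1) k
      simp only [Finset.sum_const, Finset.card_univ, Fintype.card_fin, smul_eq_mul, mul_one,
        one_pow, Finset.prod_const_one, Nat.cast_id] at h
      rw [h]
      exact Finset.single_le_sum (f := fun m => Nat.multinomial Finset.univ m)
        (fun _ _ => Nat.zero_le _) (by simp [hk])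
    calc (Nat.multinomial Finset.univ m : ℝ) ≤ (d : ℝ) ^ k := by exact_mod_cast this
      _ ≤ _ := by gcongr; linarith
  have h4 : (0 : ℝ) < ∏ i, ((m i).factorial : ℝ) :=
    Finset.prod_pos fun i _ => by exact_mod_cast Nat.factorial_pos _
  unfold taylorCoeff
  rw [norm_mul, norm_inv, norm_prod]
  simp only [Complex.norm_natCast]
  calc _ ≤ (∏ i, ((m i).factorial : ℝ))⁻¹ * (k.factorial * (C / ρ ^ k)) := by
        gcongr
        refine h1 _ fun j => ?_
        rw [Pi.norm_single]; simp
    _ = Nat.multinomial Finset.univ m * (C / ρ ^ k) := by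
        rw [h2]; field_simp
    _ ≤ (d + 1) ^ k * (C / ρ ^ k) := by gcongr
    _ = C * ((d + 1) / ρ) ^ k := by rw [div_pow]; ring

theorem tsum_pow_sum_eq (x : ℝ≥0∞) :
    ∀ d : ℕ, ∑' m : Fin d → ℕ, x ^ ∑ i, m i = (∑' k : ℕ, x ^ k) ^ d
  | 0 => by simp [tsum_fintype]
  | d + 1 => by
    rw [← (Fin.consEquiv fun _ : Fin (d + 1) => ℕ).tsum_eq, ENNReal.tsum_prod']
    simp only [Fin.consEquiv_apply, Fin.sum_univ_succ, Fin.cons_zero, Fin.cons_succ, pow_add,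
      ENNReal.tsum_mul_left, ENNReal.tsum_mul_right, tsum_pow_sum_eq x d, pow_succ']

theorem exists_tsum_taylorCoeff_lt_top {F : (Fin d → ℂ) → ℂ} (hF : AnalyticAt ℂ F 0) :
    ∃ τ : ℝ, 0 < τ ∧ ∑' m, ‖taylorCoeff F m‖ₑ * ENNReal.ofReal τ ^ ∑ i, m i < ∞ := by
  obtain ⟨C, B, hC, hB, hle⟩ := norm_taylorCoeff_le hF
  -- This radius leaves a product of `d` geometric series of ratio `1/2`.
  refine ⟨1 / (2 * B), by positivity, ?_⟩
  have h : ∀ m, ‖taylorCoeff F m‖ₑ * ENNReal.ofReal (1 / (2 * B)) ^ ∑ i, m i ≤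
      ENNReal.ofReal C * (2⁻¹ : ℝ≥0∞) ^ ∑ i, m i := by
    intro m
    rw [← ofReal_norm, ← ENNReal.ofReal_pow (by positivity),
      ← ENNReal.ofReal_mul (norm_nonneg _),
      show (2⁻¹ : ℝ≥0∞) = ENNReal.ofReal (2⁻¹ : ℝ) by
        rw [ENNReal.ofReal_inv_of_pos two_pos]; simp,
      ← ENNReal.ofReal_pow (by positivity), ← ENNReal.ofReal_mul hC.le]
    refine ENNReal.ofReal_le_ofReal ?_
    calc _ ≤ C * B ^ (∑ i, m i) * (1 / (2 * B)) ^ (∑ i, m i) := by gcongr; exact hle m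
      _ = C * 2⁻¹ ^ (∑ i, m i) := by
        rw [mul_assoc, ← mul_pow]; congr 2; field_simp
  refine (ENNReal.tsum_le_tsum h).trans_lt ?_
  rw [ENNReal.tsum_mul_left, tsum_pow_sum_eq, ENNReal.tsum_geometric]
  refine ENNReal.mul_lt_top (by simp) (ENNReal.pow_lt_top ?_)
  simp

end Taylor

/-! ### Second order expansion of a substitution -/

section Expansion

variable {d : ℕ}

/-- The product `∏ i, (m i choose p i)` of binomial coefficients. -/
def multiChoose (m p : Fin d → ℕ) : ℕ := ∏ i, (m i).choose (p i)

/-- The multi-indices `p ≤ m`. -/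
def indicesLE (m : Fin d → ℕ) : Finset (Fin d → ℕ) :=
  Fintype.piFinset fun i => Finset.range (m i + 1)

/-- Stated over any commutative semiring because it is used twice: to expand monomials in formal
series, and in `ℝ≥0∞` to reassemble the majorants. -/
theorem prod_add_pow {R : Type*} [CommSemiring R] (u v : Fin d → R) (m : Fin d → ℕ) :
    ∏ i, (u i + v i) ^ m i = ∑ p ∈ indicesLE m,
      multiChoose m p • ((∏ i, u i ^ p i) * ∏ i, v i ^ (m i - p i)) := by
  simp_rw [add_pow]
  rw [Finset.prod_univ_sum]
  refine Finset.sum_congr rfl fun p _ => ?_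
  rw [Finset.prod_mul_distrib, Finset.prod_mul_distrib, nsmul_eq_mul, multiChoose, Nat.cast_prod]
  ring

theorem exists_add_single {p : Fin d → ℕ} (hp : 1 ≤ ∑ i, p i) :
    ∃ (i : Fin d) (p' : Fin d → ℕ), p = p' + Pi.single i 1 := by
  obtain ⟨i, -, hi⟩ : ∃ i ∈ Finset.univ, p i ≠ 0 := by
    by_contra! h
    rw [Finset.sum_eq_zero h] at hp
    omega
  refine ⟨i, p - Pi.single i 1, ?_⟩
  rw [tsub_add_cancel_of_le]
  intro j
  by_cases h : j = i
  · subst h; simp; omega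
  · simp [h]

theorem sum_add_single (p : Fin d → ℕ) (i : Fin d) :
    ∑ j, (p + Pi.single i 1 : Fin d → ℕ) j = ∑ j, p j + 1 := by
  simp [Finset.sum_add_distrib]

theorem mono_add_single (y : Fin d → FSeries) (p : Fin d → ℕ) (i : Fin d) :
    mono y (p + Pi.single i 1) = y i * mono y p := by
  unfold mono
  simp only [Pi.add_apply, pow_add, Finset.prod_mul_distrib]
  rw [mul_comm]
  congr 1
  rw [Finset.prod_eq_single i] <;> simp +contextual

theorem mono_zero (y : Fin d → FSeries) : mono y 0 = 1 := by simp [mono]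

/-- The terms of order at least two in `U` of the monomial `(Y + U)^m`. -/
noncomputable def quadTerm (Y U : Fin d → FSeries) (m : Fin d → ℕ) : FSeries :=
  ∑ p ∈ (indicesLE m).filter fun p => 2 ≤ ∑ i, p i, multiChoose m p • (mono U p * mono Y (m - p))

/-- The term linear in `U i` of the monomial `(Y + U)^m`. -/
noncomputable def linTerm (Y U : Fin d → FSeries) (i : Fin d) (m : Fin d → ℕ) : FSeries :=
  m i • (U i * mono Y (m - Pi.single i 1))

theorem mono_add (Y U : Fin d → FSeries) (m : Fin d → ℕ) :
    mono (Y + U) m = mono Y m + ∑ i, linTerm Y U i m + quadTerm Y U m := by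
  classical
  have h0 : mono (Y + U) m =
      ∑ p ∈ indicesLE m, multiChoose m p • (mono U p * mono Y (m - p)) := by
    rw [add_comm Y U]
    exact prod_add_pow U Y m
  have hlt : (indicesLE m).filter (fun p => ¬ 2 ≤ ∑ i, p i) =
      insert 0 ((Finset.univ.filter fun i => m i ≠ 0).image fun i => Pi.single i 1) := by
    ext p
    simp only [Finset.mem_filter, Finset.mem_insert, Finset.mem_image, Finset.mem_univ, true_and,
      indicesLE, Fintype.mem_piFinset, Finset.mem_range]
    constructor
    · rintro ⟨h1, h2⟩
      by_cases hp : 1 ≤ ∑ i, p i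
      · right
        obtain ⟨i, p', rfl⟩ := exists_add_single hp
        rw [sum_add_single] at h2
        have h3 : p' = 0 := by
          have : ∑ j, p' j = 0 := by omega
          rw [Finset.sum_eq_zero_iff] at this
          funext j; exact this j (Finset.mem_univ j)
        subst h3
        refine ⟨i, ?_, by simp⟩
        have := h1 i
        simp at this
        omega
      · left
        have : ∑ j, p j = 0 := by omega
        rw [Finset.sum_eq_zero_iff] at this
        funext j; exact this j (Finset.mem_univ j)
    · rintro (rfl | ⟨i, hi, rfl⟩)
      · simp
      · refine ⟨fun j => ?_, by simp⟩
        by_cases h : j = i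
        · subst h; simp; omega
        · simp [h]
  have hinj : Function.Injective fun i : Fin d => (Pi.single i 1 : Fin d → ℕ) := by
    intro i j h
    by_contra hij
    have := congrFun h i
    simp [hij] at this
  rw [h0, ← Finset.sum_filter_add_sum_filter_not (indicesLE m) fun p => 2 ≤ ∑ i, p i, hlt,
    Finset.sum_insert, Finset.sum_image fun i _ j _ h => hinj h, add_comm, quadTerm]
  · congr 2
    · simp [multiChoose, mono_zero]
    · rw [Finset.sum_filter]
      refine Finset.sum_congr rfl fun i _ => ?_
      have h1 : multiChoose m (Pi.single i 1) = m i := by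
        unfold multiChoose
        rw [Finset.prod_eq_single i] <;> simp +contextual
      have h2 : mono U (Pi.single i 1) = U i := by
        simpa [mono_zero] using mono_add_single U 0 i
      unfold linTerm
      rw [h1, h2]
      by_cases hi : m i = 0 <;> simp [hi]
  · simp only [Finset.mem_image, not_exists, not_and]
    intro i _ h
    have := congrFun h i
    simp at this

theorem wnorm_nsmul (W : Expo → ℝ≥0∞) (n : ℕ) (f : FSeries) :
    wnorm W (n • f) = n * wnorm W f := by
  rw [← Nat.cast_smul_eq_nsmul ℂ, wnorm_smul]
  congr 1
  rw [← ofReal_norm]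
  simp

theorem SuppGE.nsmul {p : ℝ} {f : FSeries} (hf : SuppGE p f) (n : ℕ) : SuppGE p (n • f) := by
  rw [← Nat.cast_smul_eq_nsmul ℂ]
  exact hf.smul _

theorem suppGE_linTerm {K : ℝ} {Y U : Fin d → FSeries} (hY : ∀ i, SuppGE 0 (Y i))
    (hU : ∀ i, SuppGE K (U i)) (i : Fin d) (m : Fin d → ℕ) : SuppGE K (linTerm Y U i m) := by
  refine SuppGE.nsmul ?_ _
  simpa using (hU i).mul (suppGE_mono hY _)

theorem suppGE_quadTerm {K : ℝ} (hK : 0 ≤ K) {Y U : Fin d → FSeries} (hY : ∀ i, SuppGE 0 (Y i))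
    (hU : ∀ i, SuppGE K (U i)) (m : Fin d → ℕ) : SuppGE K (quadTerm Y U m) := by
  refine SuppGE.sum fun p hp => SuppGE.nsmul ?_ _
  obtain ⟨i, p', rfl⟩ := exists_add_single
    (one_le_two.trans (Finset.mem_filter.1 hp).2)
  rw [mono_add_single, mul_assoc]
  have h0 := (suppGE_mono (fun i => (hU i).mono hK) p').mul (suppGE_mono hY (m - (p' + Pi.single i 1)))
  simpa using (hU i).mul h0

/-- Two factors of `U` can be split off from each term. Each has exponents of real part at least
`K`, which confines the other to the truncation at `h - K`. Since `t ≤ ρ`, `t^|p| ≤ (t/ρ)^2 ρ^|p|`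
for `|p| ≥ 2`, and the binomial formula sums the rest. -/
theorem wnorm_quadTerm_le {C r h K : ℝ} (hC : 0 ≤ C) (hr : 0 < r) (hK : 0 ≤ K)
    {Y U : Fin d → FSeries} (hY : ∀ i, SuppGE 0 (Y i)) (hU : ∀ i, SuppGE K (U i))
    {s t ρ : ℝ≥0∞} (hs : ∀ i, wnorm (weight C r) (Y i) ≤ s)
    (ht : ∀ i, wnorm (cut (h - K) (weight C r)) (U i) ≤ t) (htρ : t ≤ ρ) (hρ : ρ ≠ 0)
    (hρ' : ρ ≠ ∞) (m : Fin d → ℕ) :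
    wnorm (cut h (weight C r)) (quadTerm Y U m) ≤ (t / ρ) ^ 2 * (s + ρ) ^ ∑ i, m i := by
  have hU0 : ∀ i, SuppGE 0 (U i) := fun i => (hU i).mono hK
  have key : ∀ p ∈ (indicesLE m).filter fun p => 2 ≤ ∑ i, p i,
      wnorm (cut h (weight C r)) (multiChoose m p • (mono U p * mono Y (m - p))) ≤
        (t / ρ) ^ 2 * multiChoose m p • ((∏ i, ρ ^ p i) * ∏ i, s ^ (m i - p i)) := by
    intro p hp
    have hp2 := (Finset.mem_filter.1 hp).2
    obtain ⟨i, p₁, rfl⟩ := exists_add_single (one_le_two.trans hp2)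
    rw [sum_add_single] at hp2
    obtain ⟨j, p₂, rfl⟩ := exists_add_single (p := p₁) (by omega)
    rw [wnorm_nsmul, nsmul_eq_mul, mul_left_comm]
    gcongr
    set q := m - (p₂ + Pi.single j 1 + Pi.single i 1) with hq
    have hY' := suppGE_mono hY q
    have hU' := suppGE_mono hU0 p₂
    have hw := isWeight_cut hC hr (h - K)
    rw [mono_add_single, mono_add_single, mul_assoc, mul_assoc]
    have hUY : SuppGE 0 (mono U p₂ * mono Y q) := by simpa using hU'.mul hY'
    have hc : ∀ f, wnorm (cut (h - 0 - K) (weight C r)) f ≤ wnorm (cut (h - K) (weight C r)) f := by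
      intro f; rw [sub_zero]
    have b0 : wnorm (cut (h - K) (weight C r)) (mono U p₂ * mono Y q) ≤
        t ^ (∑ i, p₂ i) * s ^ ∑ i, q i :=
      (wnorm_mul_le fun a ha b hb => hw.add_le a b (hU' a ha) (hY' b hb)).trans
        (mul_le_mul' (hw.wnorm_mono_le hU0 ht p₂) (hw.wnorm_mono_le hY
          (fun i => (wnorm_mono fun e _ => cut_le _ _ e).trans (hs i)) q))
    have b1 : wnorm (cut (h - K) (weight C r)) (U j * (mono U p₂ * mono Y q)) ≤
        t * (t ^ (∑ i, p₂ i) * s ^ ∑ i, q i) :=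
      (wnorm_mul_le fun a ha b hb => hw.add_le a b (hU0 j a ha) (hUY b hb)).trans
        (mul_le_mul' (ht j) b0)
    have b2 := (wnorm_cut_mul_le (N := h) hC hr (hU i) ((hU j).mul hUY)).trans
      (mul_le_mul' ((wnorm_mono fun e _ => cut_mono (by linarith) _ e).trans (ht i)) b1)
    refine b2.trans ?_
    rw [Finset.prod_pow_eq_pow_sum, Finset.prod_pow_eq_pow_sum, sum_add_single, sum_add_single]
    have hdiv : (t / ρ) ^ 2 * ρ ^ 2 = t ^ 2 := by
      rw [← mul_pow, ENNReal.div_mul_cancel hρ hρ']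
    have hsq : ∑ l, q l = ∑ l, (m l - (p₂ + Pi.single j 1 + Pi.single i 1 : Fin d → ℕ) l) := rfl
    rw [← hsq]
    calc t * (t * (t ^ (∑ i, p₂ i) * s ^ ∑ i, q i))
        = t ^ 2 * (t ^ (∑ i, p₂ i) * s ^ ∑ i, q i) := by ring
      _ ≤ t ^ 2 * (ρ ^ (∑ i, p₂ i) * s ^ ∑ i, q i) := by gcongr
      _ = _ := by rw [← hdiv]; ring
  calc _ ≤ ∑ p ∈ (indicesLE m).filter fun p => 2 ≤ ∑ i, p i, _ :=
        (wnorm_sum_le _ _ _).trans (Finset.sum_le_sum key)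
    _ ≤ ∑ p ∈ indicesLE m, _ := Finset.sum_le_sum_of_subset (Finset.filter_subset _ _)
    _ = (t / ρ) ^ 2 * (s + ρ) ^ ∑ i, m i := by
      rw [← Finset.mul_sum, ← prod_add_pow (fun _ => ρ) (fun _ => s) m,
        Finset.prod_pow_eq_pow_sum, add_comm]

theorem mul_smul_series (c : ℂ) (f g : FSeries) : f * (c • g) = c • (f * g) := by
  rw [← HahnSeries.single_zero_mul_eq_smul, ← HahnSeries.single_zero_mul_eq_smul, mul_left_comm]

theorem summableFamily_sum_apply {ι κ : Type*} (S : Finset κ)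
    (f : κ → HahnSeries.SummableFamily Expo ℂ ι) (m : ι) : (∑ i ∈ S, f i) m = ∑ i ∈ S, f i m := by
  classical
  induction S using Finset.induction_on with
  | empty => simp
  | insert i S hi ih => rw [Finset.sum_insert hi, Finset.sum_insert hi]; simp [ih]

theorem summableFamily_hsum_sum {ι κ : Type*} (S : Finset κ)
    (f : κ → HahnSeries.SummableFamily Expo ℂ ι) : (∑ i ∈ S, f i).hsum = ∑ i ∈ S, (f i).hsum := by
  classical
  induction S using Finset.induction_on with
  | empty => simp
  | insert i S hi ih => rw [Finset.sum_insert hi, Finset.sum_insert hi]; simp [ih]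

/-- Second order Taylor expansion of a substitution. -/
theorem exists_subst_expansion {F : (Fin d → ℂ) → ℂ} (hF : AnalyticAt ℂ F 0)
    {y Y U : Fin d → FSeries} (h : y = Y + U) (hy : ∀ i, IsGeneralized (y i))
    (hY : ∀ i, IsGeneralized (Y i)) :
    ∃ Q : FSeries, subst F y hy =
        subst F Y hY + ∑ i, U i * subst (partialDeriv F i) Y hY + Q ∧
      ∀ {K : ℝ}, 0 ≤ K → (∀ i, SuppGE K (U i)) → ∀ {C r N : ℝ} {s t ρ : ℝ≥0∞}, 0 ≤ C → 0 < r →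
        (∀ i, wnorm (weight C r) (Y i) ≤ s) →
        (∀ i, wnorm (cut (N - K) (weight C r)) (U i) ≤ t) → t ≤ ρ → ρ ≠ 0 → ρ ≠ ∞ →
        wnorm (cut N (weight C r)) Q ≤
          (t / ρ) ^ 2 * ∑' m, ‖taylorCoeff F m‖ₑ * (s + ρ) ^ ∑ i, m i := by
  let a := taylorCoeff F
  let emb : Fin d → (Fin d → ℕ) ↪ (Fin d → ℕ) := fun i => addRightEmbedding (Pi.single i 1)
  -- The family of `U i` times the substituted `∂_i F`, reindexed by `m ↦ m + e_i` so that it is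
  -- comparable with the expansion of the monomial `m`.
  let lin : Fin d → HahnSeries.SummableFamily Expo ℂ (Fin d → ℕ) := fun i =>
    (U i • substFamily (taylorCoeff (partialDeriv F i)) Y hY).embDomain (emb i)
  -- Defining the remainder as a difference makes the expansion immediate; its members are then
  -- recognised as the quadratic terms.
  let q := substFamily a y hy - substFamily a Y hY - ∑ i, lin i
  have hlin : ∀ i m, lin i m = a m • linTerm Y U i m := by
    intro i m
    by_cases hm : m i = 0
    · have : m ∉ Set.range (emb i) := by
        rintro ⟨m', rfl⟩
        simp [emb] at hm
      rw [HahnSeries.SummableFamily.embDomain_of_notMem_range _ _ this]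
      simp [linTerm, hm]
    · obtain ⟨m', rfl⟩ : ∃ m', m = emb i m' := by
        refine ⟨m - Pi.single i 1, ?_⟩
        simp only [emb, addRightEmbedding_apply]
        rw [tsub_add_cancel_of_le]
        intro j
        by_cases hj : j = i
        · subst hj; simp; omega
        · simp [hj]
      rw [HahnSeries.SummableFamily.embDomain_image, HahnSeries.SummableFamily.smul_apply,
        HahnSeries.of_symm_smul_of_eq_mul]
      change U i * (taylorCoeff (partialDeriv F i) m' • mono Y m') = _
      rw [taylorCoeff_partialDeriv hF]
      simp only [emb, addRightEmbedding_apply, linTerm, add_tsub_cancel_right, a]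
      rw [← Nat.cast_smul_eq_nsmul ℂ, smul_smul, mul_smul_series, mul_comm]
      simp
  have hq : ∀ m, q m = a m • quadTerm Y U m := by
    intro m
    have h1 : q m = a m • mono y m - a m • mono Y m - ∑ i, lin i m := by
      simp only [q, HahnSeries.SummableFamily.sub_apply, summableFamily_sum_apply]
      rfl
    rw [h1, h, mono_add]
    simp only [hlin, smul_add, Finset.smul_sum]
    abel
  refine ⟨q.hsum, ?_, ?_⟩
  · have : q.hsum = subst F y hy - subst F Y hY -
        ∑ i, U i * subst (partialDeriv F i) Y hY := by
      simp only [q, HahnSeries.SummableFamily.hsum_sub, summableFamily_hsum_sum, lin,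
        HahnSeries.SummableFamily.hsum_embDomain, HahnSeries.SummableFamily.hsum_smul]
      rfl
    rw [this]; abel
  · intro K hK hU C r N s t ρ hC hr hs ht htρ hρ hρ'
    refine (wnorm_hsum_le _ _).trans ?_
    rw [← ENNReal.tsum_mul_left]
    refine ENNReal.tsum_le_tsum fun m => ?_
    rw [hq, wnorm_smul, mul_left_comm]
    gcongr
    exact wnorm_quadTerm_le hC hr hK (fun i => (hY i).suppGE) hU hs ht htρ hρ hρ' m

/-- Every nonconstant term in `U` of each monomial contains a factor `U i`. This transfers the
hypothesis on leading terms from `φ` to its finite part. -/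
theorem suppGE_subst_sub (F : (Fin d → ℂ) → ℂ) {y Y U : Fin d → FSeries} (h : y = Y + U)
    (hy : ∀ i, IsGeneralized (y i)) (hY : ∀ i, IsGeneralized (Y i)) {K : ℝ} (hK : 0 ≤ K)
    (hU : ∀ i, SuppGE K (U i)) : SuppGE K (subst F y hy - subst F Y hY) := by
  unfold subst
  rw [← HahnSeries.SummableFamily.hsum_sub]
  refine SuppGE.hsum fun m => ?_
  have h1 : (substFamily (taylorCoeff F) y hy - substFamily (taylorCoeff F) Y hY) m =
      taylorCoeff F m • (∑ i, linTerm Y U i m + quadTerm Y U m) := by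
    change taylorCoeff F m • mono y m - taylorCoeff F m • mono Y m = _
    rw [h, mono_add]
    simp only [smul_add]
    abel
  rw [h1]
  exact ((SuppGE.sum fun i _ => suppGE_linTerm (fun i => (hY i).suppGE) hU i m).add
    (suppGE_quadTerm hK (fun i => (hY i).suppGE) hU m)).smul _

theorem wnorm_subst_le (F : (Fin d → ℂ) → ℂ) {Y : Fin d → FSeries}
    (hY : ∀ i, IsGeneralized (Y i)) {W : Expo → ℝ≥0∞} (hW : IsWeight W) {s : ℝ≥0∞}
    (hs : ∀ i, wnorm W (Y i) ≤ s) :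
    wnorm W (subst F Y hY) ≤ ∑' m, ‖taylorCoeff F m‖ₑ * s ^ ∑ i, m i := by
  refine (wnorm_hsum_le _ _).trans (ENNReal.tsum_le_tsum fun m => ?_)
  change wnorm W (taylorCoeff F m • mono Y m) ≤ _
  rw [wnorm_smul]
  gcongr
  exact hW.wnorm_mono_le (fun i => (hY i).suppGE) hs m

end Expansion

/-! ### The operator `δ`, splitting of series, and inversion of `∑ A_j δ^j` -/

theorem coeff_delta_iterate (f : FSeries) (j : ℕ) (e : Expo) :
    (delta^[j] f).coeff e = e.toComplex ^ j * f.coeff e := by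
  induction j with
  | zero => simp
  | succ j ih =>
    rw [Function.iterate_succ_apply']
    change e.toComplex * (delta^[j] f).coeff e = _
    rw [ih, pow_succ]; ring

/-- The part of `f` with exponents in `S`. -/
noncomputable def restrict (S : Set Expo) (f : FSeries) : FSeries where
  coeff := S.indicator f.coeff
  isPWO_support' := f.isPWO_support.mono fun e he h => he (by simp [Set.indicator, h])

theorem support_restrict (S : Set Expo) (f : FSeries) :
    (restrict S f).support ⊆ f.support ∩ S := by
  intro e he
  have he' : S.indicator f.coeff e ≠ 0 := he
  exact ⟨fun h => he' (by simp [Set.indicator, h]), Set.mem_of_indicator_ne_zero he'⟩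

theorem restrict_add_restrict_compl (S : Set Expo) (f : FSeries) :
    restrict S f + restrict Sᶜ f = f := by
  ext e
  exact congrFun (Set.indicator_self_add_compl S f.coeff) e

theorem IsGeneralized.restrict {f : FSeries} (hf : IsGeneralized f) (S : Set Expo) :
    IsGeneralized (restrict S f) :=
  ⟨fun e he => hf.1 e (support_restrict S f he).1, fun N =>
    (hf.2 N).subset fun _ he => ⟨(support_restrict S f he.1).1, he.2⟩⟩

theorem support_delta_iterate (f : FSeries) (j : ℕ) : (delta^[j] f).support ⊆ f.support := by
  intro e he h
  exact he (by rw [coeff_delta_iterate, h, mul_zero])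

theorem SuppGE.delta_iterate {p : ℝ} {f : FSeries} (hf : SuppGE p f) (j : ℕ) :
    SuppGE p (delta^[j] f) := fun e he => hf e (support_delta_iterate f j he)

theorem Expo.re_le_norm (e : Expo) : e.re ≤ ‖e.toComplex‖ := Complex.re_le_norm e.toComplex

/-- Exponents satisfy `|e| ≥ Re e ≥ 1`, so `|e|^j ≤ |e|^n`: the top derivative dominates all lower
ones. -/
theorem wnorm_delta_iterate_le {f : FSeries} (hf : SuppGE 1 f) (W : Expo → ℝ≥0∞) {j n : ℕ}
    (h : j ≤ n) : wnorm W (delta^[j] f) ≤ wnorm W (delta^[n] f) := by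
  refine ENNReal.tsum_le_tsum fun e => ?_
  rw [coeff_delta_iterate, coeff_delta_iterate]
  by_cases he : f.coeff e = 0
  · simp [he]
  · gcongr
    rw [← ofReal_norm, ← ofReal_norm, norm_mul, norm_mul, norm_pow, norm_pow]
    have h1 : 1 ≤ ‖e.toComplex‖ := (hf e he).trans e.re_le_norm
    exact ENNReal.ofReal_le_ofReal (by gcongr)

theorem exists_rpow_mul_le {ε : ℝ} (hε : 0 < ε) (B : ℝ) {s : ℝ} (hs : 0 < s) :
    ∃ r₀ : ℝ, 0 < r₀ ∧ r₀ ≤ 1 ∧ ∀ r, 0 < r → r ≤ r₀ → B * r ^ ε ≤ s := by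
  have h : Tendsto (fun r : ℝ => B * r ^ ε) (𝓝 0) (𝓝 (B * 0 ^ ε)) :=
    ((Real.continuous_rpow_const hε.le).tendsto 0).const_mul B
  rw [Real.zero_rpow hε.ne', mul_zero] at h
  obtain ⟨δ, hδ, hlt⟩ := Metric.eventually_nhds_iff.1 (h.eventually (gt_mem_nhds hs))
  refine ⟨min (δ / 2) 1, by positivity, min_le_right _ _, fun r hr hr' => (hlt ?_).le⟩
  rw [Real.dist_eq, sub_zero, abs_of_pos hr]
  linarith [hr'.trans (min_le_left _ _)]

theorem exists_wnorm_le {f : FSeries} (hf : IsGeneralized f) (hfin : f.support.Finite) (C : ℝ)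
    {s : ℝ} (hs : 0 < s) : ∃ r₀ : ℝ, 0 < r₀ ∧ r₀ ≤ 1 ∧ ∀ r, 0 < r → r ≤ r₀ →
      wnorm (weight C r) f ≤ ENNReal.ofReal s := by
  obtain ⟨ε, hε, hle⟩ := exists_pos_bound hf
  have hB : wnorm (weight C 1) f < ∞ := wnorm_lt_top hfin (weight_ne_top C 1)
  obtain ⟨r₀, h0, h1, h⟩ := exists_rpow_mul_le hε (wnorm (weight C 1) f).toReal hs
  refine ⟨r₀, h0, h1, fun r hr hr' => ?_⟩
  refine (wnorm_le_mul _ fun e he =>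
    weight_le_mul (p := ε) hr (hr'.trans h1) (hle e he)).trans ?_
  rw [div_one, ← ENNReal.ofReal_toReal hB.ne, ← ENNReal.ofReal_mul (by positivity), mul_comm]
  exact ENNReal.ofReal_le_ofReal (h r hr hr')

theorem exists_le_norm_sum_pow {n : ℕ} (A : Fin (n + 1) → ℂ) (hA : A (Fin.last n) ≠ 0) :
    ∃ c K : ℝ, 0 < c ∧ ∀ z : ℂ, K ≤ ‖z‖ → c * ‖z‖ ^ n ≤ ‖∑ j, A j * z ^ (j : ℕ)‖ := by
  set S := ∑ j : Fin n, ‖A j.castSucc‖ with hS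
  have ha : 0 < ‖A (Fin.last n)‖ := norm_pos_iff.2 hA
  refine ⟨‖A (Fin.last n)‖ / 2, max 1 (2 * S / ‖A (Fin.last n)‖), by positivity, fun z hz => ?_⟩
  have h1 : 1 ≤ ‖z‖ := (le_max_left _ _).trans hz
  have h2 : 2 * S ≤ ‖z‖ * ‖A (Fin.last n)‖ := by
    rw [← div_le_iff₀ ha]; exact (le_max_right _ _).trans hz
  rw [Fin.sum_univ_castSucc]
  simp only [Fin.val_castSucc, Fin.val_last]
  have h3 : ‖∑ j : Fin n, A j.castSucc * z ^ (j : ℕ)‖ * ‖z‖ ≤ S * ‖z‖ ^ n := by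
    rw [hS, Finset.sum_mul]
    refine (mul_le_mul_of_nonneg_right (norm_sum_le _ _) (norm_nonneg z)).trans ?_
    rw [Finset.sum_mul]
    refine Finset.sum_le_sum fun j _ => ?_
    rw [norm_mul, norm_pow, mul_assoc, ← pow_succ]
    gcongr
    exact j.2
  have h4 : ‖A (Fin.last n)‖ * ‖z‖ ^ n ≤ ‖∑ j : Fin n, A j.castSucc * z ^ (j : ℕ) +
      A (Fin.last n) * z ^ n‖ + ‖∑ j : Fin n, A j.castSucc * z ^ (j : ℕ)‖ := by
    rw [← norm_pow, ← norm_mul]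
    simpa using norm_sub_le (∑ j : Fin n, A j.castSucc * z ^ (j : ℕ) + A (Fin.last n) * z ^ n)
      (∑ j : Fin n, A j.castSucc * z ^ (j : ℕ))
  have h5 : ‖∑ j : Fin n, A j.castSucc * z ^ (j : ℕ)‖ ≤ ‖A (Fin.last n)‖ / 2 * ‖z‖ ^ n := by
    have hz0 : 0 < ‖z‖ := by linarith
    refine le_of_mul_le_mul_right (h3.trans ?_) hz0
    have : 0 ≤ ‖z‖ ^ n := by positivity
    nlinarith
  linarith

/-- Inversion of the operator `∑ A_j δ^j` on series with large exponents. -/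
theorem wnorm_delta_iterate_le_of_eq {n : ℕ} {A : Fin (n + 1) → ℂ} {c K : ℝ} (hc : 0 ≤ c)
    (hL : ∀ z : ℂ, K ≤ ‖z‖ → c * ‖z‖ ^ n ≤ ‖∑ j, A j * z ^ (j : ℕ)‖) {u B : FSeries}
    (hu : SuppGE K u) (ν : ℂ)
    (hB : B = -∑ j : Fin (n + 1), delta^[j] u * HahnSeries.single (toExpo ν) (A j))
    {C r : ℝ} (hC : 0 ≤ C) (hr : 0 < r) (N : ℝ) :
    ENNReal.ofReal c * wnorm (cut N (weight C r)) (delta^[n] u) ≤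
      weight C r (-toExpo ν) * wnorm
        (fun e => if K + ν.re ≤ e.re then cut (N + ν.re) (weight C r) e else 0) B := by
  set W' : Expo → ℝ≥0∞ :=
    fun e => if K + ν.re ≤ e.re then cut (N + ν.re) (weight C r) e else 0 with hW'
  -- The operator is diagonal on monomials, so inverting it means dividing by the polynomial at `e`,
  -- up to the shift by `ν`.
  have hcoeff : ∀ e, B.coeff (e + toExpo ν) =
      -((∑ j : Fin (n + 1), A j * e.toComplex ^ (j : ℕ)) * u.coeff e) := by
    intro e
    rw [hB, HahnSeries.coeff_neg, HahnSeries.coeff_sum, Finset.sum_mul]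
    congr 1
    refine Finset.sum_congr rfl fun j _ => ?_
    rw [HahnSeries.coeff_mul_single, add_sub_cancel_right, coeff_delta_iterate]
    ring
  unfold wnorm
  rw [← (Equiv.addRight (toExpo ν)).tsum_eq fun e => ‖B.coeff e‖ₑ * W' e, ← ENNReal.tsum_mul_left,
    ← ENNReal.tsum_mul_left]
  refine ENNReal.tsum_le_tsum fun e => ?_
  rw [Equiv.coe_addRight, hcoeff, coeff_delta_iterate]
  by_cases he : u.coeff e = 0
  · simp [he]
  have hK : K ≤ e.re := hu e he
  by_cases hN : e.re ≤ N
  · have hre : (e + toExpo ν).re = e.re + ν.re := rfl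
    have h1 : W' (e + toExpo ν) = weight C r (e + toExpo ν) := by
      simp only [hW', cut, hre]
      rw [if_pos (by linarith), if_pos (by linarith)]
    have h2 : cut N (weight C r) e ≤ weight C r (e + toExpo ν) * weight C r (-toExpo ν) := by
      rw [cut, if_pos hN]
      simpa using weight_add_le hC hr (e + toExpo ν) (-toExpo ν)
    have h3 : ENNReal.ofReal c * ‖e.toComplex ^ n * u.coeff e‖ₑ ≤
        ‖-((∑ j : Fin (n + 1), A j * e.toComplex ^ (j : ℕ)) * u.coeff e)‖ₑ := by
      rw [← ofReal_norm, ← ofReal_norm, ← ENNReal.ofReal_mul hc]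
      refine ENNReal.ofReal_le_ofReal ?_
      rw [norm_neg, norm_mul, norm_mul, norm_pow, ← mul_assoc]
      gcongr
      exact hL _ (hK.trans e.re_le_norm)
    rw [h1, ← mul_assoc]
    calc _ ≤ _ := mul_le_mul' h3 h2
      _ = _ := by ring
  · simp [cut, hN]

theorem wnorm_le_of_cut_le {W : Expo → ℝ≥0∞} {f : FSeries} {R : ℝ≥0∞} {ε : ℝ} (hε : 0 < ε)
    (h : ∀ k : ℕ, wnorm (cut (k * ε) W) f ≤ R) : wnorm W f ≤ R := by
  unfold wnorm
  rw [ENNReal.tsum_eq_iSup_sum]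
  refine iSup_le fun S => ?_
  obtain ⟨M, hM⟩ := (S.image Expo.re).bddAbove
  obtain ⟨k, hk⟩ := exists_nat_ge (M / ε)
  rw [div_le_iff₀ hε] at hk
  refine le_trans ?_ ((ENNReal.sum_le_tsum S).trans (h k))
  refine Finset.sum_le_sum fun e he => ?_
  rw [cut, if_pos]
  exact (hM (Finset.mem_coe.2 (Finset.mem_image_of_mem _ he))).trans hk

/-- The support is well ordered lexicographically, so its least element attains the minimal real
part and leaves a gap above `σ`. -/
theorem exists_suppGE_of_lt {f : FSeries} {σ : ℝ} (h : ∀ e ∈ f.support, σ < e.re) :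
    ∃ ε : ℝ, 0 < ε ∧ ε ≤ 1 ∧ SuppGE (σ + ε) f := by
  by_cases hne : f.support.Nonempty
  · have hm := h _ (Set.IsWF.min_mem f.isWF_support hne)
    refine ⟨min ((f.isWF_support.min hne).re - σ) 1, lt_min (by linarith) one_pos,
      min_le_right _ _, fun e he => ?_⟩
    have h1 := Expo.re_le_of_le (Set.IsWF.min_le f.isWF_support hne he)
    linarith [min_le_left ((f.isWF_support.min hne).re - σ) 1]
  · exact ⟨1, one_pos, le_rfl, fun e he => (hne ⟨e, he⟩).elim⟩

theorem analyticAt_partialDeriv {d : ℕ} {F : (Fin d → ℂ) → ℂ} (hF : AnalyticAt ℂ F 0)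
    (i : Fin d) : AnalyticAt ℂ (partialDeriv F i) 0 :=
  ((ContinuousLinearMap.apply ℂ ℂ (Pi.single i 1 : Fin d → ℂ)).analyticAt _).comp hF.fderiv

/-! ### Jets and the a priori estimate -/

/-- The series `(0, u, δu, …, δⁿu)`. -/
noncomputable def jetIncr (n : ℕ) (u : FSeries) : Fin (n + 2) → FSeries :=
  Fin.cons 0 fun j : Fin (n + 1) => delta^[j] u

theorem jet_eq_add (n : ℕ) (S : Set Expo) (f : FSeries) :
    jet n f = jet n (restrict S f) + jetIncr n (restrict Sᶜ f) := by
  funext i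
  refine Fin.cases ?_ (fun j => ?_) i
  · simp [jet, jetIncr]
  · simp only [jet, jetIncr, Pi.add_apply, Fin.cons_succ]
    ext e
    conv_lhs => rw [← restrict_add_restrict_compl S f]
    simp only [HahnSeries.coeff_add, coeff_delta_iterate]
    ring

theorem suppGE_jetIncr {n : ℕ} {p : ℝ} {u : FSeries} (hu : SuppGE p u) (i : Fin (n + 2)) :
    SuppGE p (jetIncr n u i) := by
  refine Fin.cases ?_ (fun j => ?_) i
  · simpa [jetIncr] using suppGE_zero p
  · simpa [jetIncr] using hu.delta_iterate j

theorem wnorm_jetIncr_le {n : ℕ} {u : FSeries} (hu : SuppGE 1 u) (W : Expo → ℝ≥0∞)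
    (i : Fin (n + 2)) : wnorm W (jetIncr n u i) ≤ wnorm W (delta^[n] u) := by
  refine Fin.cases ?_ (fun j => ?_) i
  · simp [jetIncr, wnorm_zero]
  · simpa [jetIncr] using wnorm_delta_iterate_le hu W (Nat.lt_succ_iff.1 j.2)

theorem finite_support_jet {n : ℕ} {f : FSeries} (hf : f.support.Finite) (i : Fin (n + 2)) :
    (jet n f i).support.Finite := by
  refine Fin.cases ?_ (fun j => ?_) i
  · exact (Set.finite_singleton (toExpo 1)).subset HahnSeries.support_single_subset
  · exact hf.subset (support_delta_iterate f j)

/-- Common radii for finitely many smallness conditions. -/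
theorem exists_common_radius {ι : Type*} [Finite ι] {P : ι → ℝ → Prop}
    (h : ∀ i, ∃ r₀ : ℝ, 0 < r₀ ∧ r₀ ≤ 1 ∧ ∀ r, 0 < r → r ≤ r₀ → P i r) :
    ∃ r₀ : ℝ, 0 < r₀ ∧ r₀ ≤ 1 ∧ ∀ r, 0 < r → r ≤ r₀ → ∀ i, P i r := by
  choose r h0 h1 hP using h
  rcases isEmpty_or_nonempty ι with hι | hι
  · exact ⟨1, one_pos, le_rfl, fun _ _ _ i => hι.elim i⟩
  · obtain ⟨i, hi⟩ := Finite.exists_min r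
    exact ⟨r i, h0 i, h1 i, fun x hx hx' j => hP j x hx (hx'.trans (hi j))⟩

theorem wnorm_weight_cut_le {C r r₀ p : ℝ} (hr : 0 < r) (hr₀ : r ≤ r₀) {f : FSeries}
    (hf : SuppGE p f) (N : ℝ) : wnorm (cut N (weight C r)) f ≤
      ENNReal.ofReal ((r / r₀) ^ p) * wnorm (weight C r₀) f :=
  wnorm_le_mul _ fun e he => (cut_le _ _ e).trans (weight_le_mul hr hr₀ (hf e he))

/-- The a priori estimate on truncations, in terms of the previous truncation. -/
theorem wnorm_cut_step {n : ℕ} {A : Fin (n + 1) → ℂ} {ν : ℂ} {c K : ℝ} (hc : 0 ≤ c)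
    (hL : ∀ z : ℂ, K ≤ ‖z‖ → c * ‖z‖ ^ n ≤ ‖∑ j, A j * z ^ (j : ℕ)‖) {u B P Q : FSeries}
    {D : Fin (n + 1) → FSeries} {ε : ℝ} (hK : 1 ≤ K) (hu : SuppGE K u)
    (hD : ∀ j, SuppGE (ν.re + ε) (D j))
    (hB : B = -∑ j : Fin (n + 1), delta^[j] u * HahnSeries.single (toExpo ν) (A j))
    (hB' : B = P + ∑ j : Fin (n + 1), delta^[j] u * D j + Q)
    {C r r₀ : ℝ} (hC : 0 ≤ C) (hr : 0 < r) (hr₀ : r ≤ r₀) (N : ℝ) {a q : ℝ≥0∞}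
    (ha : wnorm (cut (N - ε) (weight C r)) (delta^[n] u) ≤ a)
    (hq : wnorm (cut (N + ν.re) (weight C r)) Q ≤ q) :
    ENNReal.ofReal c * wnorm (cut N (weight C r)) (delta^[n] u) ≤
      weight C r (-toExpo ν) *
        (ENNReal.ofReal ((r / r₀) ^ (K + ν.re)) * wnorm (weight C r₀) P +
          a * (ENNReal.ofReal ((r / r₀) ^ (ν.re + ε)) * ∑ j, wnorm (weight C r₀) (D j)) + q) := by
  refine (wnorm_delta_iterate_le_of_eq hc hL hu ν hB hC hr N).trans ?_
  gcongr
  rw [hB']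
  refine (wnorm_add_le _ _ _).trans (add_le_add ((wnorm_add_le _ _ _).trans (add_le_add ?_ ?_)) ?_)
  -- Only the part of `P` with `Re e ≥ K + Re ν` is counted: lower exponents cancel within `B`.
  -- Hence the gain of the power `K + ν.re`.
  · refine wnorm_le_mul _ fun e _ => ?_
    split_ifs with h
    · exact (cut_le _ _ e).trans (weight_le_mul hr hr₀ h)
    · exact zero_le
  · refine (wnorm_sum_le _ _ _).trans ?_
    rw [Finset.mul_sum, Finset.mul_sum]
    refine Finset.sum_le_sum fun j _ => ?_
    refine (wnorm_mono (W' := cut (N + ν.re) (weight C r)) fun e _ => ?_).trans ?_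
    · split_ifs <;> simp
    · refine (wnorm_cut_mul_le hC hr (hu.delta_iterate j) (hD j)).trans (mul_le_mul' ?_ ?_)
      · refine (wnorm_delta_iterate_le (hu.mono hK) _ (Nat.lt_succ_iff.1 j.2)).trans ?_
        rwa [show N + ν.re - (ν.re + ε) = N - ε by ring]
      · exact wnorm_weight_cut_le hr hr₀ (hD j) _
  · refine (wnorm_mono (W' := cut (N + ν.re) (weight C r)) fun e _ => ?_).trans hq
    split_ifs <;> simp

/-- A formal solution has finite weighted norm for small radii. -/
theorem exists_wnorm_lt_top {n : ℕ} {F : (Fin (n + 2) → ℂ) → ℂ} (hF : AnalyticAt ℂ F 0)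
    {φ : GenPowerSeries} (hφ : IsFormalSolution F φ) {ν : ℂ} {A : Fin (n + 1) → ℂ}
    (hA : ∀ j : Fin (n + 1), HasLeadingTerm (evalAlong (partialDeriv F j.succ) φ) (A j) ν)
    (hAn : A (Fin.last n) ≠ 0) {C : ℝ} (hC : 0 ≤ C) :
    ∃ r : ℝ, 0 < r ∧ wnorm (weight C r) φ.toFSeries < ∞ := by
  obtain ⟨c, K₀, hc, hL₀⟩ := exists_le_norm_sum_pow A hAn
  -- `K₀` makes the polynomial invertible; `2` gives `r^(K-1) ≤ r`; `ν.re + 2` puts `u` beyond the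
  -- leading terms and makes the quadratic remainder negligible against `x^ν`.
  set K : ℝ := max K₀ (max 2 (ν.re + 2)) with hKdef
  have hKK₀ : K₀ ≤ K := le_max_left _ _
  have hK2 : 2 ≤ K := (le_max_left _ _).trans (le_max_right _ _)
  have hKν : ν.re + 2 ≤ K := (le_max_right _ _).trans (le_max_right _ _)
  have hL := fun z (hz : K ≤ ‖z‖) => hL₀ z (hKK₀.trans hz)
  -- splitting of `φ`
  set f := φ.toFSeries with hf
  have hfg : IsGeneralized f := φ.isGeneralized
  let S : Set Expo := {e | e.re < K}
  set f₀ := restrict S f with hf₀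
  set u := restrict Sᶜ f with hu
  have hf₀g : IsGeneralized f₀ := hfg.restrict S
  have hf₀fin : f₀.support.Finite := (hfg.2 K).subset fun e he =>
    ⟨(support_restrict S f he).1, le_of_lt (support_restrict S f he).2⟩
  have huK : SuppGE K u := fun e he => not_lt.1 (support_restrict Sᶜ f he).2
  have hjet : jet n f = jet n f₀ + jetIncr n u := jet_eq_add n S f
  have hYg := isGeneralized_jet n hf₀g
  have hUK := suppGE_jetIncr (n := n) huK
  -- the remainders of the leading terms
  let G : Fin (n + 1) → FSeries := fun j => subst (partialDeriv F j.succ) (jet n f₀) hYg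
  let D : Fin (n + 1) → FSeries := fun j => G j - HahnSeries.single (toExpo ν) (A j)
  obtain ⟨ε, hε, hε1, hD⟩ : ∃ ε : ℝ, 0 < ε ∧ ε ≤ 1 ∧ ∀ j, SuppGE (ν.re + ε) (D j) := by
    have h : ∀ j, ∃ ε : ℝ, 0 < ε ∧ ε ≤ 1 ∧ SuppGE (ν.re + ε) (D j) := by
      intro j
      refine exists_suppGE_of_lt fun e he => ?_
      by_contra hlt
      -- Passing from `φ` to `f₀` alters only exponents of real part at least `K > Re ν`.
      have h1 := suppGE_subst_sub (partialDeriv F j.succ) hjet (isGeneralized_jet n hfg) hYg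
        (by linarith) hUK
      have h2 : D j = (evalAlong (partialDeriv F j.succ) φ - HahnSeries.single (toExpo ν) (A j)) -
          (subst (partialDeriv F j.succ) (jet n f) (isGeneralized_jet n hfg) - G j) := by
        simp only [D, evalAlong]; abel
      refine he ?_
      rw [h2, HahnSeries.coeff_sub]
      have h3 : (evalAlong (partialDeriv F j.succ) φ -
          HahnSeries.single (toExpo ν) (A j)).coeff e = 0 := by
        by_contra h; exact hlt (hA j e h)
      have h4 : (subst (partialDeriv F j.succ) (jet n f) (isGeneralized_jet n hfg) -
          G j).coeff e = 0 := by
        by_contra h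
        have := h1 e h
        linarith
      rw [h3, h4, sub_zero]
    choose ε h0 h1 h using h
    obtain ⟨i, hi⟩ := Finite.exists_min ε
    exact ⟨ε i, h0 i, h1 i, fun j => (h j).mono (by linarith [hi j])⟩
  -- the linearized equation
  obtain ⟨Q, hexp, hQ⟩ := exists_subst_expansion hF hjet (isGeneralized_jet n hfg) hYg
  set P := subst F (jet n f₀) hYg with hP
  set B := P + ∑ j : Fin (n + 1), delta^[j] u * D j + Q with hB
  have hB' : B = -∑ j : Fin (n + 1), delta^[j] u * HahnSeries.single (toExpo ν) (A j) := by
    have h0 : P + ∑ j : Fin (n + 1), delta^[j] u * G j + Q = 0 := by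
      have h1 : subst F (jet n f) (isGeneralized_jet n hfg) = 0 := hφ
      rw [h1, Fin.sum_univ_succ] at hexp
      simpa [jetIncr, G] using hexp.symm
    rw [hB, eq_neg_iff_add_eq_zero, ← h0]
    simp only [D, mul_sub, Finset.sum_sub_distrib]
    abel
  -- radii
  obtain ⟨τ₀, hτ₀, hM₀⟩ := exists_tsum_taylorCoeff_lt_top hF
  have hτj := fun j : Fin (n + 1) =>
    exists_tsum_taylorCoeff_lt_top (analyticAt_partialDeriv hF j.succ)
  choose τ hτ hM using hτj
  -- Room for two summands of size `s`: the jet of `f₀`, and the auxiliary radius `ρ = s` for the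
  -- increment.
  obtain ⟨s, hs, hsτ₀, hsτ⟩ : ∃ s : ℝ, 0 < s ∧ s + s ≤ τ₀ ∧ ∀ j, s ≤ τ j := by
    obtain ⟨i, hi⟩ := Finite.exists_min τ
    refine ⟨min (τ₀ / 2) (τ i), lt_min (by linarith) (hτ i), ?_, fun j =>
      (min_le_right _ _).trans (hi j)⟩
    linarith [min_le_left (τ₀ / 2) (τ i)]
  obtain ⟨r₀, hr₀, hr₀1, hY⟩ := exists_common_radius fun i =>
    exists_wnorm_le (hYg i) (finite_support_jet hf₀fin i) C hs
  set M := ∑' m, ‖taylorCoeff F m‖ₑ * (ENNReal.ofReal s + ENNReal.ofReal s) ^ ∑ i, m i with hMdef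
  have hMtop : M < ∞ := by
    refine lt_of_le_of_lt (ENNReal.tsum_le_tsum fun m => ?_) hM₀
    rw [← ENNReal.ofReal_add hs.le hs.le]
    gcongr
  have hw₀ := isWeight_weight hC hr₀
  have hPtop : wnorm (weight C r₀) P < ∞ := by
    refine lt_of_le_of_lt ((wnorm_subst_le F hYg hw₀ (hY r₀ hr₀ le_rfl)).trans
      (ENNReal.tsum_le_tsum fun m => ?_)) hM₀
    gcongr
    linarith
  have hDtop : ∑ j, wnorm (weight C r₀) (D j) < ∞ := by
    refine ENNReal.sum_lt_top.2 fun j _ => ?_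
    have h1 : D j = G j + -HahnSeries.single (toExpo ν) (A j) := sub_eq_add_neg _ _
    rw [h1]
    refine (wnorm_add_le _ _ _).trans_lt (ENNReal.add_lt_top.2 ⟨?_, ?_⟩)
    · refine lt_of_le_of_lt ((wnorm_subst_le _ hYg hw₀ (hY r₀ hr₀ le_rfl)).trans
        (ENNReal.tsum_le_tsum fun m => ?_)) (hM j)
      gcongr
      exact hsτ j
    · rw [wnorm_neg, wnorm_single]
      exact ENNReal.mul_lt_top (by simp) (weight_ne_top _ _ _).lt_top
  set p₁ := (wnorm (weight C r₀) P).toReal with hp₁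
  set p₂ := (∑ j, wnorm (weight C r₀) (D j)).toReal with hp₂
  set p₃ := M.toReal with hp₃
  set E := Real.exp (C * |(ofLex (-toExpo ν)).2|) with hE
  set q₁ := p₁ / r₀ ^ (K + ν.re) with hq₁
  set q₂ := p₂ / r₀ ^ (ν.re + ε) with hq₂
  set q₃ := p₃ / s ^ 2 with hq₃
  -- After division by `x^ν`, the three contributions are at most `E q_i r^ε R`; this radius makes
  -- their sum at most `c R`.
  obtain ⟨r₁, hr₁, hr₁1, hsmall⟩ := exists_rpow_mul_le hε (E * (q₁ + q₂ + q₃)) hc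
  set r := min r₀ (min r₁ s) with hrdef
  have hr : 0 < r := by positivity
  have hrr₀ : r ≤ r₀ := min_le_left _ _
  have hrr₁ : r ≤ r₁ := (min_le_right _ _).trans (min_le_left _ _)
  have hrs : r ≤ s := (min_le_right _ _).trans (min_le_right _ _)
  have hr1 : r ≤ 1 := hrr₀.trans hr₀1
  have hEpos : 0 < E := Real.exp_pos _
  have hq₁0 : 0 ≤ q₁ := by positivity
  have hq₂0 : 0 ≤ q₂ := by positivity
  have hq₃0 : 0 ≤ q₃ := by positivity
  -- The term `P` contributes order `r^K`, so exponent `K - 1` leaves a spare factor `r`, while `R^2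
  -- r^(-Re ν)` is still small against `R`.
  set R := r ^ (K - 1) with hRdef
  have hR : 0 < R := by positivity
  have hRs : R ≤ s := by
    refine le_trans ?_ hrs
    simpa using Real.rpow_le_rpow_of_exponent_ge hr hr1 (show (1 : ℝ) ≤ K - 1 by linarith)
  -- the real inequality behind the induction step
  have hreal : r ^ (-ν.re) * E * ((r / r₀) ^ (K + ν.re) * p₁ +
      R * ((r / r₀) ^ (ν.re + ε) * p₂) + (R / s) ^ 2 * p₃) ≤ c * R := by
    have k1 : r ^ (1 : ℝ) * R = r ^ (-ν.re) * r ^ (K + ν.re) := by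
      rw [hRdef, ← Real.rpow_add hr, ← Real.rpow_add hr]
      ring_nf
    have k2 : r ^ ε = r ^ (-ν.re) * r ^ (ν.re + ε) := by
      rw [← Real.rpow_add hr]
      ring_nf
    have e1 : r ^ (-ν.re) * ((r / r₀) ^ (K + ν.re) * p₁) = q₁ * (r ^ (1 : ℝ) * R) := by
      rw [hq₁, Real.div_rpow hr.le hr₀.le, k1]
      ring
    have e2 : r ^ (-ν.re) * (R * ((r / r₀) ^ (ν.re + ε) * p₂)) = q₂ * (r ^ ε * R) := by
      rw [hq₂, Real.div_rpow hr.le hr₀.le, k2]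
      ring
    have e3 : r ^ (-ν.re) * ((R / s) ^ 2 * p₃) = q₃ * (r ^ (K - 1 - ν.re) * R) := by
      rw [hq₃, show K - 1 - ν.re = -ν.re + (K - 1) by ring, Real.rpow_add hr, ← hRdef]
      ring
    have l1 : r ^ (1 : ℝ) ≤ r ^ ε := Real.rpow_le_rpow_of_exponent_ge hr hr1 hε1
    have l3 : r ^ (K - 1 - ν.re) ≤ r ^ ε :=
      Real.rpow_le_rpow_of_exponent_ge hr hr1 (by linarith)
    calc _ = E * (q₁ * (r ^ (1 : ℝ) * R) + q₂ * (r ^ ε * R) +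
          q₃ * (r ^ (K - 1 - ν.re) * R)) := by rw [← e1, ← e2, ← e3]; ring
      _ ≤ E * (q₁ * (r ^ ε * R) + q₂ * (r ^ ε * R) + q₃ * (r ^ ε * R)) := by gcongr
      _ = E * (q₁ + q₂ + q₃) * r ^ ε * R := by ring
      _ ≤ c * R := by gcongr; exact hsmall r hr hrr₁
  have hreal' : weight C r (-toExpo ν) *
        (ENNReal.ofReal ((r / r₀) ^ (K + ν.re)) * wnorm (weight C r₀) P +
          ENNReal.ofReal R *
            (ENNReal.ofReal ((r / r₀) ^ (ν.re + ε)) * ∑ j, wnorm (weight C r₀) (D j)) +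
          (ENNReal.ofReal R / ENNReal.ofReal s) ^ 2 * M) ≤
      ENNReal.ofReal c * ENNReal.ofReal R := by
    have hre : (-toExpo ν).re = -ν.re := rfl
    rw [weight, hre, ← hE, ← ENNReal.ofReal_toReal hPtop.ne, ← ENNReal.ofReal_toReal hDtop.ne,
      ← ENNReal.ofReal_toReal hMtop.ne, ← hp₁, ← hp₂, ← hp₃, ← ENNReal.ofReal_div_of_pos hs,
      ← ENNReal.ofReal_pow (by positivity), ← ENNReal.ofReal_mul (by positivity),
      ← ENNReal.ofReal_mul (by positivity), ← ENNReal.ofReal_mul (by positivity),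
      ← ENNReal.ofReal_mul (by positivity), ← ENNReal.ofReal_add (by positivity) (by positivity),
      ← ENNReal.ofReal_add (by positivity) (by positivity), ← ENNReal.ofReal_mul (by positivity),
      ← ENNReal.ofReal_mul hc.le]
    exact ENNReal.ofReal_le_ofReal hreal
  -- the induction
  have hind : ∀ k : ℕ, wnorm (cut (k * ε) (weight C r)) (delta^[n] u) ≤ ENNReal.ofReal R := by
    intro k
    induction k with
    | zero =>
      refine (wnorm_mono (W' := fun _ => 0) fun e he => ?_).trans (by simp [wnorm])
      have := huK.delta_iterate n e he
      rw [cut, if_neg]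
      push_cast
      linarith
    | succ k ih =>
      have hN : ((k + 1 : ℕ) : ℝ) * ε - ε = k * ε := by push_cast; ring
      have hQ' := hQ (by linarith) hUK (N := ((k + 1 : ℕ) : ℝ) * ε + ν.re) (t := ENNReal.ofReal R)
        hC hr (hY r hr hrr₀) (fun i => (wnorm_jetIncr_le (huK.mono (by linarith)) _ i).trans
          ((wnorm_mono fun e _ => cut_mono (by linarith) _ e).trans ih))
        (ENNReal.ofReal_le_ofReal hRs) (by simpa using hs) ENNReal.ofReal_ne_top
      have := (wnorm_cut_step hc.le hL (by linarith) huK hD hB' hB hC hr hrr₀ _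
        (by rwa [hN]) hQ').trans hreal'
      exact (ENNReal.mul_le_mul_iff_right (by simpa using hc) ENNReal.ofReal_ne_top).1 this
  refine ⟨r, hr, ?_⟩
  rw [← restrict_add_restrict_compl S f]
  refine (wnorm_add_le _ _ _).trans_lt (ENNReal.add_lt_top.2
    ⟨wnorm_lt_top hf₀fin (weight_ne_top C r), ?_⟩)
  exact ((wnorm_delta_iterate_le (j := 0) (huK.mono (by linarith)) _ n.zero_le).trans
    (wnorm_le_of_cut_le hε hind)).trans_lt ENNReal.ofReal_lt_top

/-! ### From finite norm to uniform convergence on sectors -/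

theorem GenPowerSeries.coeff_toFSeries (φ : GenPowerSeries) (k : ℕ) :
    φ.toFSeries.coeff (toExpo (φ.expo k)) = φ.coeff k := by
  unfold GenPowerSeries.toFSeries
  rw [HahnSeries.SummableFamily.coeff_hsum, finsum_eq_single _ k]
  · exact HahnSeries.coeff_single_same _ _
  · intro l hl
    refine HahnSeries.coeff_single_of_ne fun h => hl (φ.expo_injective ?_)
    have h' := congrArg ofLex h
    simp only [toExpo, ofLex_toLex, Prod.mk.injEq] at h'
    exact (Complex.ext h'.1 h'.2).symm

theorem toExpo_injective : Function.Injective toExpo := by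
  intro a b h
  have h' := congrArg ofLex h
  simp only [toExpo, ofLex_toLex, Prod.mk.injEq] at h'
  exact Complex.ext h'.1 h'.2

/-- `|x^s| = |x|^{Re s} exp(-Im s · arg x)`, and on the sector the argument is bounded by `max |α|
|β|`. This is the reason for the exponential factor in the weight. -/
theorem norm_powFrom_le {α β r : ℝ} {x s : ℂ} (hx : x ∈ sector α β r) (hs : 0 ≤ s.re) :
    ‖powFrom α x s‖ ≤ r ^ s.re * Real.exp (max |α| |β| * |s.im|) := by
  obtain ⟨h0, h1, h2⟩ := hx
  have h3 : α < argFrom α x := (toIocMod_mem_Ioc Real.two_pi_pos α x.arg).1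
  have h4 : |argFrom α x| ≤ max |α| |β| := abs_le_max_abs_abs h3.le h2.le
  unfold powFrom
  rw [Complex.norm_exp]
  have h5 : (s * (Real.log ‖x‖ + argFrom α x * Complex.I)).re =
      Real.log ‖x‖ * s.re + -(s.im * argFrom α x) := by
    simp [Complex.mul_re]; ring
  rw [h5, Real.exp_add, ← Real.rpow_def_of_pos h0]
  refine mul_le_mul (Real.rpow_le_rpow h0.le h1.le hs) (Real.exp_le_exp.2 ?_)
    (Real.exp_pos _).le (Real.rpow_nonneg (h0.le.trans h1.le) _)
  calc -(s.im * argFrom α x) ≤ |s.im * argFrom α x| := neg_le_abs _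
    _ = |argFrom α x| * |s.im| := by rw [abs_mul, mul_comm]
    _ ≤ _ := by gcongr

end GenSeries

theorem mainTheorem2 (n : ℕ) (F : (Fin (n + 2) → ℂ) → ℂ) (hF : AnalyticAt ℂ F 0)
    (φ : GenSeries.GenPowerSeries) (hφ : GenSeries.IsFormalSolution F φ)
    (ν : ℂ) (A : Fin (n + 1) → ℂ)
    (hA : ∀ j : Fin (n + 1), GenSeries.HasLeadingTerm
      (GenSeries.evalAlong (GenSeries.partialDeriv F j.succ) φ) (A j) ν)
    (hAn : A (Fin.last n) ≠ 0)
    (α β : ℝ) (hαβ : α < β) (hopening : β - α < 2 * Real.pi) :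
    ∃ r : ℝ, 0 < r ∧ ∃ f : ℂ → ℂ,
      TendstoUniformlyOn
        (fun (N : ℕ) (x : ℂ) =>
          ∑ k ∈ Finset.range N, φ.coeff k * GenSeries.powFrom α x (φ.expo k))
        f Filter.atTop (GenSeries.sector α β r) := by
  set C : ℝ := max |α| |β| with hC
  obtain ⟨r, hr, hfin⟩ := GenSeries.exists_wnorm_lt_top hF hφ hA hAn
    (C := C) (le_max_of_le_left (abs_nonneg α))
  refine ⟨r, hr, _, tendstoUniformlyOn_tsum_nat
    (u := fun k => ‖φ.coeff k‖ * (r ^ (φ.expo k).re * Real.exp (C * |(φ.expo k).im|))) ?_ ?_⟩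
  · have h1 : ∑' k, ENNReal.ofReal
        (‖φ.coeff k‖ * (r ^ (φ.expo k).re * Real.exp (C * |(φ.expo k).im|))) ≠ ⊤ := by
      refine ne_top_of_le_ne_top hfin.ne ?_
      -- The exponents are distinct, so the majorant series is a subseries of the weighted norm.
      refine le_trans (le_of_eq ?_) (ENNReal.tsum_comp_le_tsum_of_injective
        (GenSeries.toExpo_injective.comp φ.expo_injective)
        fun e => ‖φ.toFSeries.coeff e‖ₑ * GenSeries.weight C r e)
      refine tsum_congr fun k => ?_
      rw [Function.comp_apply, φ.coeff_toFSeries, ENNReal.ofReal_mul (norm_nonneg _), ofReal_norm]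
      rfl
    have h2 := ENNReal.summable_toReal h1
    refine h2.congr fun k => ENNReal.toReal_ofReal (by positivity)
  · intro k x hx
    rw [norm_mul]
    gcongr
    exact GenSeries.norm_powFrom_le hx (φ.re_pos.le.trans (φ.re_mono (Nat.zero_le k)))
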